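/- Let $G$ be a finite group with identity element $1_G$ and let $\exp(G)=\operatorname{lcm}\{\operatorname{ord}(g) : g\in G\}$. A sequence over $G$ is a finite unordered sequence of terms from $G$, repetition allowed (that is, a finite multiset); it is a product-one sequence if its terms can be ordered so that their product is $1_G$. Let $\mathsf s(G)$ denote the Erdős–Ginzburg–Ziv constant of $G$, that is, the smallest integer $\ell$ such that every sequence over $G$ of length at least $\ell$ has a product-one subsequence of length $\exp(G)$. Theorem 1.1. Let $n$ be a positive integer. 1. If $n\ge 3$ and $G$ is a dihedral group of order $2n$, that is, $G\cong\langle \alpha,\tau \mid \alpha^n=\tau^2=1,\ \tau\alpha=\alpha^{-1}\tau\rangle$, then $\mathsf s(G)=3n$ if $n$ is odd, and $\mathsf s(G)=2n$ if $n$ is even. 2. If $n\ge 2$ and $G$ is a dicyclic group of order $4n$, that is, $G\cong\langle \alpha,\tau \mid \alpha^{2n}=1,\ \tau^2=\alpha^n,\ \tau\alpha=\alpha^{-1}\tau\rangle$, then $\mathsf s(G)=6n$ if $n$ is odd, and $\mathsf s(G)=4n$ if $n$ is even. -/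

import Mathlib

/-- A finite unordered sequence over `G` (a multiset of terms) is a product-one sequence if its
terms can be ordered so that their product is the identity. -/
def IsProductOne {G : Type*} [Group G] (S : Multiset G) : Prop :=
  ∃ l : List G, (l : Multiset G) = S ∧ l.prod = 1

/-- The set of all `ℓ` such that every sequence over `G` of length at least `ℓ` has a
product-one subsequence of length `exp G`. -/
def egzLengths (G : Type*) [Group G] : Set ℕ :=
  {ℓ | ∀ S : Multiset G, ℓ ≤ S.card →
    ∃ T : Multiset G, T ≤ S ∧ T.card = Monoid.exponent G ∧ IsProductOne T}

/-- `ℓ` is the Erdős–Ginzburg–Ziv constant of `G`: the smallest element of `egzLengths G`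
(in particular that set is nonempty). -/
def IsEGZConstant (G : Type*) [Group G] (ℓ : ℕ) : Prop :=
  IsLeast (egzLengths G) ℓ

/-- `G` is a dihedral group of order `2n`. -/
def IsDihedralOfOrderTwoMul (G : Type*) [Group G] (n : ℕ) : Prop :=
  Nonempty (G ≃* DihedralGroup n)

/-- `G` is a dicyclic group of order `4n`. Mathlib's `QuaternionGroup n` is the dicyclic group
`⟨α, τ | α ^ (2n) = 1, τ ^ 2 = α ^ n, τ α = α⁻¹ τ⟩`. -/
def IsDicyclicOfOrderFourMul (G : Type*) [Group G] (n : ℕ) : Prop :=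
  Nonempty (G ≃* QuaternionGroup n)

/-! ### Submultisets -/

/-! Both families consist of a cyclic group of order `m` and a coset of elements inverting it;
`DihedralRep` treats them together. With `e` the exponent, the constant is `e + m` in all four
cases.

Lower bound (`exists_not_hasProductOne`): take `e - 1` copies of a generator of the cyclic group, `m
- 1` identities and one element of the other coset. The last cannot occur in a product-one sequence.
Among the rotations, a zero sum of length `e` uses a multiple of `m` of generators; as `m ∣ e`, the
number of identities is also a multiple of `m`, hence zero, and there are too few generators.

The upper bound rests on a dichotomy. In a product `A y B z` with `y`, `z` outside the rotations,
the rotation `B` is inverted, so the rotations placed around two such terms contribute a sum with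
free signs (`Twisted`). For odd `n`, signed sums in `ZMod n` are shifted subset sums of the doubled
terms, and these fill the group once enough terms lie outside each proper subgroup
(`subsetSums_eq_univ_or`, a Kneser-type argument). If instead too many terms lie in a subgroup, the
Erdős–Ginzburg–Ziv theorem inside it gives a zero sum.

For dihedral groups with `n` odd, this is applied to products of pairs from the same coset
(`hasProductOne_of_odd`). For `n` even, quotients with cyclic kernel reduce the claim to `n = 4` and
`n = 2 * p` with `p` an odd prime, where pairs of equal coset and parity are used. Dicyclic groups
with `n` even reduce to dihedral ones modulo the central involution, apart from `n = 2`. The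
dicyclic case with `n` odd (`hasProductOne_of_two_mul_odd`) needs the residues mod `n` and the
parity to be controlled separately. -/

theorem Multiset.exists_le_card_eq' {β : Type*} (s : Multiset β) {k : ℕ} (hk : k ≤ s.card) :
    ∃ t ≤ s, t.card = k := by
  induction s using Quotient.inductionOn with
  | h l =>
    refine ⟨(l.take k : List β), ?_, ?_⟩
    · exact (List.take_sublist k l).subperm
    · simpa using hk

theorem Multiset.exists_between_card_eq {β : Type*} {s t : Multiset β} (h : s ≤ t) {k : ℕ}
    (hs : s.card ≤ k) (ht : k ≤ t.card) : ∃ u, s ≤ u ∧ u ≤ t ∧ u.card = k := by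
  obtain ⟨r, rfl⟩ := Multiset.le_iff_exists_add.1 h
  rw [Multiset.card_add] at ht
  obtain ⟨v, hv, hvk⟩ := Multiset.exists_le_card_eq' r (k := k - s.card) (by omega)
  exact ⟨s + v, Multiset.le_add_right _ _, by gcongr, by rw [Multiset.card_add]; omega⟩

theorem Multiset.exists_map_eq_of_le_map {β γ : Type*} {f : β → γ} {s : Multiset β}
    {t : Multiset γ} (h : t ≤ s.map f) : ∃ u ≤ s, u.map f = t := by
  induction s using Quotient.inductionOn with
  | h l =>
    induction t using Quotient.inductionOn with
    | h l' =>
      obtain ⟨l'', hp, hs⟩ : l'.Subperm (l.map f) := h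
      obtain ⟨u, hu, rfl⟩ := List.sublist_map_iff.1 hs
      exact ⟨(u : List β), hu.subperm, by simpa using hp⟩

theorem Multiset.sum_le_sum_of_le {G : Type*} {V W : Multiset (Multiset G)} (h : V ≤ W) :
    V.sum ≤ W.sum := by
  obtain ⟨r, rfl⟩ := Multiset.le_iff_exists_add.1 h
  rw [Multiset.sum_add]
  exact Multiset.le_add_right _ _

theorem Multiset.card_sum_of_forall {G : Type*} {V : Multiset (Multiset G)} {q : ℕ}
    (h : ∀ b ∈ V, b.card = q) : V.sum.card = V.card * q := by
  induction V using Multiset.induction_on with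
  | empty => simp
  | cons b V ih =>
    rw [Multiset.sum_cons, Multiset.card_add, ih fun b' hb' => h b' (Multiset.mem_cons_of_mem hb'),
      h b (Multiset.mem_cons_self b V), Multiset.card_cons]
    ring

/-- Elements can be grouped into pairs lying in the same class, with at most one element of each
class left over. -/
theorem Multiset.exists_pairing {G κ : Type*} (f : G → κ) (S : Multiset G) :
    ∃ (V : Multiset (Multiset G)) (L : Multiset G), V.sum + L = S ∧
      (∀ b ∈ V, ∃ g h, b = {g} + {h} ∧ f g = f h) ∧ (L.map f).Nodup := by
  classical
  induction S using Multiset.induction_on with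
  | empty => exact ⟨0, 0, by simp, by simp, by simp⟩
  | cons g S ih =>
    obtain ⟨V, L, rfl, hV, hL⟩ := ih
    by_cases hg : f g ∈ L.map f
    · obtain ⟨h, hh, hgh⟩ := Multiset.mem_map.1 hg
      obtain ⟨L, rfl⟩ := Multiset.exists_cons_of_mem hh
      refine ⟨({g} + {h}) ::ₘ V, L, ?_, ?_, ?_⟩
      · rw [Multiset.sum_cons, ← Multiset.singleton_add g, ← Multiset.singleton_add h L]
        abel
      · intro b hb
        rcases Multiset.mem_cons.1 hb with rfl | hb
        · exact ⟨g, h, rfl, hgh.symm⟩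
        · exact hV b hb
      · rw [Multiset.map_cons] at hL
        exact (Multiset.nodup_cons.1 hL).2
    · refine ⟨V, g ::ₘ L, by rw [Multiset.add_cons], hV, ?_⟩
      rw [Multiset.map_cons]
      exact Multiset.nodup_cons.2 ⟨hg, hL⟩

/-- Repeated extraction of disjoint blocks of a fixed length. -/
theorem Multiset.exists_blocks {G : Type*} {P : Multiset G → Prop} {s q : ℕ}
    (hP : ∀ S : Multiset G, s ≤ S.card → ∃ T ≤ S, T.card = q ∧ P T) (N : ℕ) :
    ∀ S : Multiset G, s + q * N ≤ S.card + q →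
      ∃ V : Multiset (Multiset G), V.sum ≤ S ∧ V.card = N ∧ ∀ b ∈ V, b.card = q ∧ P b := by
  classical
  induction N with
  | zero => exact fun S _ => ⟨0, by simp, by simp, by simp⟩
  | succ N ih =>
    intro S hS
    have h1 : s ≤ S.card := by
      have : q * (N + 1) = q * N + q := by ring
      have := Nat.zero_le (q * N)
      omega
    obtain ⟨T, hT, hTq, hPT⟩ := hP S h1
    obtain ⟨R, rfl⟩ := Multiset.le_iff_exists_add.1 hT
    rw [Multiset.card_add, hTq] at hS
    obtain ⟨V, hV, hVN, hVP⟩ := ih R (by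
      have : q * (N + 1) = q * N + q := by ring
      omega)
    refine ⟨T ::ₘ V, ?_, by simp [hVN], ?_⟩
    · rw [Multiset.sum_cons]
      gcongr
    · intro b hb
      rcases Multiset.mem_cons.1 hb with rfl | hb
      · exact ⟨hTq, hPT⟩
      · exact hVP b hb

/-! ### Products of sequences -/

section OrderedProd

variable {G : Type*} [Group G]

/-- The terms of `T` can be ordered so that their product is `g`. -/
def OrderedProd (T : Multiset G) (g : G) : Prop :=
  ∃ l : List G, (l : Multiset G) = T ∧ l.prod = g

theorem OrderedProd.add {T U : Multiset G} {g h : G} (hT : OrderedProd T g)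
    (hU : OrderedProd U h) : OrderedProd (T + U) (g * h) := by
  obtain ⟨l, rfl, rfl⟩ := hT
  obtain ⟨l', rfl, rfl⟩ := hU
  exact ⟨l ++ l', by simp, by simp⟩

theorem OrderedProd.singleton (g : G) : OrderedProd {g} g := ⟨[g], by simp, by simp⟩

theorem OrderedProd.zero : OrderedProd (0 : Multiset G) 1 := ⟨[], by simp, by simp⟩

theorem OrderedProd.sum {A : Type*} [AddCommMonoid A] {ψ : A → G} (h0 : ψ 0 = 1)
    (hadd : ∀ i j, ψ i * ψ j = ψ (i + j)) {V : Multiset (Multiset G)} {v : Multiset G → A}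
    (h : ∀ b ∈ V, OrderedProd b (ψ (v b))) : OrderedProd V.sum (ψ (V.map v).sum) := by
  induction V using Multiset.induction_on with
  | empty => simpa [h0] using OrderedProd.zero
  | cons b V ih =>
    rw [Multiset.sum_cons, Multiset.map_cons, Multiset.sum_cons, ← hadd]
    exact (h b (by simp)).add (ih fun b hb => h b (by simp [hb]))

/-- `S` has a product-one subsequence of length `e`. -/
def HasProductOne (S : Multiset G) (e : ℕ) : Prop :=
  ∃ T ≤ S, T.card = e ∧ IsProductOne T

theorem HasProductOne.mono {S S' : Multiset G} {e : ℕ} (h : HasProductOne S e) (hS : S ≤ S') :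
    HasProductOne S' e :=
  let ⟨T, hT, he, h1⟩ := h
  ⟨T, hT.trans hS, he, h1⟩

end OrderedProd

/-- A description of a group as a cyclic group `rot` of order `m`, inverted by the elements `ref`
of its nontrivial coset; `c` records the square of the elements `ref i`. -/
structure DihedralRep (G : Type*) [Group G] (m : ℕ) (c : ZMod m) where
  rot : ZMod m → G
  ref : ZMod m → G
  rot_zero : rot 0 = 1
  rot_mul_rot : ∀ i j, rot i * rot j = rot (i + j)
  rot_mul_ref : ∀ i j, rot i * ref j = ref (j - i)
  ref_mul_rot : ∀ i j, ref i * rot j = ref (i + j)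
  ref_mul_ref : ∀ i j, ref i * ref j = rot (c + j - i)
  eq_rot_or_eq_ref : ∀ g, (∃ i, g = rot i) ∨ ∃ i, g = ref i
  rot_injective : Function.Injective rot
  rot_ne_ref : ∀ i j, rot i ≠ ref j

/-! ### Signed products of rotations around two elements of the other coset -/

namespace DihedralRep

variable {G : Type*} [Group G] {m : ℕ} {c : ZMod m} (D : DihedralRep G m c)

/-- `T` splits in two parts whose products are rotations with quotient `rot i`: next to a pair of
elements of the nontrivial coset, `T` can be arranged to contribute `rot i`. -/
def Twisted (T : Multiset G) (i : ZMod m) : Prop :=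
  ∃ A B α β, T = A + B ∧ OrderedProd A (D.rot α) ∧ OrderedProd B (D.rot β) ∧ i = α - β

variable {D}

theorem Twisted.of_orderedProd {T : Multiset G} {i : ZMod m} (h : OrderedProd T (D.rot i)) :
    D.Twisted T i :=
  ⟨T, 0, i, 0, by simp, h, by rw [D.rot_zero]; exact .zero, by simp⟩

theorem Twisted.add {T U : Multiset G} {i j : ZMod m} (hT : D.Twisted T i)
    (hU : D.Twisted U j) : D.Twisted (T + U) (i + j) := by
  obtain ⟨A, B, α, β, rfl, hA, hB, rfl⟩ := hT
  obtain ⟨A', B', α', β', rfl, hA', hB', rfl⟩ := hU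
  refine ⟨A + A', B + B', α + α', β + β', by abel, ?_, ?_, by abel⟩
  · rw [← D.rot_mul_rot]
    exact hA.add hA'
  · rw [← D.rot_mul_rot]
    exact hB.add hB'

/-- Exchange the two parts: each block carries a free sign. -/
theorem Twisted.neg {T : Multiset G} {i : ZMod m} (hT : D.Twisted T i) : D.Twisted T (-i) := by
  obtain ⟨A, B, α, β, rfl, hA, hB, rfl⟩ := hT
  exact ⟨B, A, β, α, by abel, hB, hA, by abel⟩

theorem Twisted.zero : D.Twisted 0 0 :=
  .of_orderedProd (by rw [D.rot_zero]; exact .zero)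

theorem Twisted.rot (i : ZMod m) : D.Twisted {D.rot i} i := .of_orderedProd (.singleton _)

/-- Order the terms as `A`, `ref y`, `B`, `ref z`: moving the product of `B` past `ref y` inverts
it. -/
theorem Twisted.orderedProd {T : Multiset G} {i : ZMod m} (hT : D.Twisted T i) (y z : ZMod m) :
    OrderedProd (T + ({D.ref y} + {D.ref z})) (D.rot (i + (c + z - y))) := by
  obtain ⟨A, B, α, β, rfl, hA, hB, rfl⟩ := hT
  have h := ((hA.add (OrderedProd.singleton (D.ref y))).add hB).add
    (OrderedProd.singleton (D.ref z))
  rw [D.rot_mul_ref, D.ref_mul_rot, D.ref_mul_ref] at h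
  convert h using 1
  · abel
  · congr 1; abel

variable (D)

theorem orderedProd_rot_pair (i j : ZMod m) :
    OrderedProd ({D.rot i} + {D.rot j}) (D.rot (i + j)) := by
  rw [← D.rot_mul_rot]
  exact (OrderedProd.singleton _).add (.singleton _)

theorem orderedProd_ref_pair (y z : ZMod m) :
    OrderedProd ({D.ref y} + {D.ref z}) (D.rot (c + z - y)) := by
  rw [← D.ref_mul_ref]
  exact (OrderedProd.singleton _).add (.singleton _)

theorem orderedProd_sum {V : Multiset (Multiset G)} {v : Multiset G → ZMod m}
    (h : ∀ b ∈ V, OrderedProd b (D.rot (v b))) :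
    OrderedProd V.sum (D.rot (V.map v).sum) :=
  .sum D.rot_zero D.rot_mul_rot h

theorem twisted_sum {V : Multiset (Multiset G)} {v : Multiset G → ZMod m}
    (h : ∀ b ∈ V, D.Twisted b (v b)) : D.Twisted V.sum (V.map v).sum := by
  induction V using Multiset.induction_on with
  | empty => simpa using Twisted.zero
  | cons b V ih =>
    rw [Multiset.sum_cons, Multiset.map_cons, Multiset.sum_cons]
    exact (h b (by simp)).add (ih fun b hb => h b (by simp [hb]))

theorem twisted_sum_sub {p q : Multiset (Multiset G)} {v : Multiset G → ZMod m}
    (h : ∀ b ∈ p + q, D.Twisted b (v b)) :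
    D.Twisted (p + q).sum ((p.map v).sum - (q.map v).sum) := by
  rw [Multiset.sum_add, sub_eq_add_neg]
  exact (D.twisted_sum fun b hb => h b (by simp [hb])).add
    (D.twisted_sum fun b hb => h b (by simp [hb])).neg

theorem orderedProd_map_rot (R : Multiset (ZMod m)) :
    OrderedProd (R.map D.rot) (D.rot R.sum) := by
  induction R using Multiset.induction_on with
  | empty => simpa [D.rot_zero] using OrderedProd.zero
  | cons b V ih =>
    rw [Multiset.map_cons, Multiset.sum_cons, ← D.rot_mul_rot, ← Multiset.singleton_add]
    exact (OrderedProd.singleton _).add ih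

theorem twisted_map_rot (p q : Multiset (ZMod m)) :
    D.Twisted ((p + q).map D.rot) (p.sum - q.sum) := by
  rw [Multiset.map_add]
  exact ⟨_, _, _, _, rfl, D.orderedProd_map_rot p, D.orderedProd_map_rot q, rfl⟩

/-- A sequence splits into its rotations and its terms in the nontrivial coset. -/
theorem exists_eq_map_add_map (S : Multiset G) :
    ∃ R Y : Multiset (ZMod m), S = R.map D.rot + Y.map D.ref := by
  induction S using Multiset.induction_on with
  | empty => exact ⟨0, 0, by simp⟩
  | cons g S ih =>
    obtain ⟨R, Y, rfl⟩ := ih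
    rcases D.eq_rot_or_eq_ref g with ⟨i, rfl⟩ | ⟨i, rfl⟩
    · exact ⟨i ::ₘ R, Y, by simp⟩
    · exact ⟨R, i ::ₘ Y, by simp⟩

variable {D}

theorem hasProductOne_of_twisted {S T : Multiset G} {i y z : ZMod m} {e : ℕ}
    (hT : D.Twisted T i) (hS : T + ({D.ref y} + {D.ref z}) ≤ S) (hi : i + (c + z - y) = 0)
    (hc : T.card + 2 = e) : HasProductOne S e := by
  refine ⟨_, hS, by simpa using hc, ?_⟩
  have := hT.orderedProd y z
  rwa [hi, D.rot_zero] at this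

theorem hasProductOne_of_sum_eq_zero {S : Multiset G} {V : Multiset (Multiset G)}
    {v : Multiset G → ZMod m} {e q : ℕ} (h : ∀ b ∈ V, OrderedProd b (D.rot (v b)))
    (hS : V.sum ≤ S) (hv : (V.map v).sum = 0) (hq : ∀ b ∈ V, b.card = q) (hc : V.card * q = e) :
    HasProductOne S e := by
  refine ⟨_, hS, by rw [Multiset.card_sum_of_forall hq, hc], ?_⟩
  have := D.orderedProd_sum h
  rwa [hv, D.rot_zero] at this

theorem hasProductOne_of_rot {S : Multiset G} {R : Multiset (ZMod m)} {e : ℕ}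
    (hS : R.map D.rot ≤ S) (hv : R.sum = 0) (hc : R.card = e) : HasProductOne S e := by
  refine ⟨_, hS, by simpa using hc, ?_⟩
  have := D.orderedProd_map_rot R
  rwa [hv, D.rot_zero] at this

end DihedralRep

/-! ### The Erdős–Ginzburg–Ziv theorem in subgroups of cyclic groups -/

theorem ZMod.exists_le_card_eq_sum_eq_zero {β : Type*} {k : ℕ} (f : β → ZMod k)
    (j : ℕ) (s : Multiset β) (hs : k * j + k ≤ s.card + 1) :
    ∃ t ≤ s, t.card = k * j ∧ (t.map f).sum = 0 := by
  classical
  induction j generalizing s with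
  | zero => exact ⟨0, by simp, by simp, by simp⟩
  | succ j ih =>
    have e : k * (j + 1) = k * j + k := by ring
    obtain ⟨t', ht', hc, h0⟩ := ZMod.erdos_ginzburg_ziv_multiset (s.map f) (by
      rw [Multiset.card_map]; omega)
    obtain ⟨t, ht, rfl⟩ := Multiset.exists_map_eq_of_le_map ht'
    rw [Multiset.card_map] at hc
    obtain ⟨r, rfl⟩ := Multiset.le_iff_exists_add.1 ht
    rw [Multiset.card_add] at hs
    obtain ⟨u, hu, huc, hu0⟩ := ih r (by omega)
    refine ⟨t + u, by gcongr, by rw [Multiset.card_add]; omega, ?_⟩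
    rw [Multiset.map_add, Multiset.sum_add, h0, hu0, add_zero]

/-- `K` is cyclic, so the Erdős–Ginzburg–Ziv theorem can be applied in `ZMod (Nat.card K)`. The
default value `0` in the transported function never matters, since `f` maps `s` into `K`. -/
theorem ZMod.exists_le_card_eq_sum_eq_zero_of_mem {β : Type*} {m : ℕ} [NeZero m]
    (f : β → ZMod m) (K : AddSubgroup (ZMod m)) {M : ℕ} (hM : Nat.card K ∣ M) (s : Multiset β)
    (hf : ∀ b ∈ s, f b ∈ K) (hs : M + Nat.card K ≤ s.card + 1) :
    ∃ t ≤ s, t.card = M ∧ (t.map f).sum = 0 := by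
  classical
  obtain ⟨j, rfl⟩ := hM
  let e := zmodAddCyclicAddEquiv (G := K) inferInstance
  obtain ⟨t, ht, hc, h0⟩ := ZMod.exists_le_card_eq_sum_eq_zero
    (fun b => if h : f b ∈ K then e.symm ⟨f b, h⟩ else 0) j s hs
  refine ⟨t, ht, hc, ?_⟩
  have : (t.map f).sum = ((e (t.map fun b => if h : f b ∈ K then e.symm ⟨f b, h⟩ else 0).sum : K) :
      ZMod m) := by
    rw [map_multiset_sum, ← AddSubgroup.coe_subtype, map_multiset_sum, Multiset.map_map,
      Multiset.map_map]
    congr 1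
    refine Multiset.map_congr rfl fun b hb => ?_
    simp [hf b (Multiset.mem_of_le ht hb)]
  rw [this, h0]
  simp

/-! ### Sums of subsequences in finite abelian groups -/

section Outside

variable {A β : Type*} [AddCommGroup A]

open Classical in
/-- The number of terms of `V` that `f` maps outside of the subgroup `K`. -/
noncomputable def outside (f : β → A) (K : AddSubgroup A) (V : Multiset β) : ℕ :=
  V.countP (f · ∉ K)

theorem outside_zero (f : β → A) (K : AddSubgroup A) : outside f K 0 = 0 := by simp [outside]

theorem outside_add (f : β → A) (K : AddSubgroup A) (V W : Multiset β) :
    outside f K (V + W) = outside f K V + outside f K W := by simp [outside]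

theorem outside_cons_of_mem {f : β → A} {K : AddSubgroup A} {b : β} (hb : f b ∈ K)
    (V : Multiset β) : outside f K (b ::ₘ V) = outside f K V := by simp [outside, hb]

theorem outside_cons_of_notMem {f : β → A} {K : AddSubgroup A} {b : β} (hb : f b ∉ K)
    (V : Multiset β) : outside f K (b ::ₘ V) = outside f K V + 1 := by simp [outside, hb]

theorem outside_cons_le (f : β → A) (K : AddSubgroup A) (b : β) (V : Multiset β) :
    outside f K (b ::ₘ V) ≤ outside f K V + 1 := by
  by_cases hb : f b ∈ K
  · rw [outside_cons_of_mem hb]; omega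
  · rw [outside_cons_of_notMem hb]

theorem outside_map {γ : Type*} (f : β → A) (g : γ → β) (K : AddSubgroup A) (V : Multiset γ) :
    outside f K (V.map g) = outside (fun x => f (g x)) K V := by
  induction V using Multiset.induction_on with
  | empty => simp [outside]
  | cons b V ih =>
    rw [Multiset.map_cons]
    by_cases hb : f (g b) ∈ K
    · rw [outside_cons_of_mem hb, outside_cons_of_mem (f := fun x => f (g x)) hb, ih]
    · rw [outside_cons_of_notMem hb, outside_cons_of_notMem (f := fun x => f (g x)) hb, ih]

theorem outside_congr {f : β → A} {g : β → A} {K : AddSubgroup A} {V : Multiset β}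
    (h : ∀ b ∈ V, f b ∈ K ↔ g b ∈ K) : outside f K V = outside g K V := by
  classical
  unfold outside
  exact Multiset.countP_congr rfl fun b hb => by simp [h b hb]

theorem outside_eq_card {f : β → A} {K : AddSubgroup A} {V : Multiset β}
    (h : ∀ b ∈ V, f b ∉ K) : outside f K V = V.card := by
  classical
  unfold outside
  exact Multiset.countP_eq_card.2 h

theorem outside_eq_zero {f : β → A} {K : AddSubgroup A} {V : Multiset β}
    (h : ∀ b ∈ V, f b ∈ K) : outside f K V = 0 := by
  classical
  unfold outside
  exact Multiset.countP_eq_zero.2 fun b hb => by simpa using h b hb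

theorem exists_inside (f : β → A) (K : AddSubgroup A) (V : Multiset β) :
    ∃ W ≤ V, (∀ b ∈ W, f b ∈ K) ∧ W.card + outside f K V = V.card := by
  classical
  refine ⟨V.filter (f · ∈ K), Multiset.filter_le _ _, fun b hb => (Multiset.mem_filter.1 hb).2, ?_⟩
  have := Multiset.card_eq_countP_add_countP (f · ∈ K) V
  rw [this, Multiset.countP_eq_card_filter]
  congr 1

theorem exists_outside (f : β → A) (K : AddSubgroup A) (V : Multiset β) :
    ∃ W ≤ V, (∀ b ∈ W, f b ∉ K) ∧ W.card = outside f K V := by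
  classical
  refine ⟨V.filter (f · ∉ K), Multiset.filter_le _ _, fun b hb => (Multiset.mem_filter.1 hb).2, ?_⟩
  rw [← Multiset.countP_eq_card_filter]
  unfold outside
  congr

end Outside

/-! ### Sets of subset sums and their periods -/

section SubsetSums

variable {A : Type*} [AddCommGroup A] [DecidableEq A]

/-- The set of sums of subsequences. -/
def subsetSums : List A → Finset A
  | [] => {0}
  | a :: l => subsetSums l ∪ (subsetSums l).image (a + ·)

theorem zero_mem_subsetSums (l : List A) : 0 ∈ subsetSums l := by
  induction l with
  | nil => simp [subsetSums]
  | cons a l ih => simp [subsetSums, ih]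

theorem mem_subsetSums_cons {a x : A} {l : List A} :
    x ∈ subsetSums (a :: l) ↔ x ∈ subsetSums l ∨ x - a ∈ subsetSums l := by
  simp only [subsetSums, Finset.mem_union, Finset.mem_image]
  refine or_congr Iff.rfl ⟨?_, fun h => ⟨_, h, by abel⟩⟩
  rintro ⟨y, hy, rfl⟩
  simpa using hy

/-- Pass to the complementary subsequence. For signed sums this becomes the symmetry `d ↦ -d`. -/
theorem sum_sub_mem_subsetSums {l : List A} {x : A} (hx : x ∈ subsetSums l) :
    l.sum - x ∈ subsetSums l := by
  induction l generalizing x with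
  | nil => simp_all [subsetSums]
  | cons a l ih =>
    rw [mem_subsetSums_cons] at hx ⊢
    rcases hx with hx | hx
    · right
      convert ih hx using 1
      rw [List.sum_cons]; abel
    · left
      convert ih hx using 1
      rw [List.sum_cons]; abel

theorem subsetSums_perm {l l' : List A} (h : l.Perm l') : subsetSums l = subsetSums l' := by
  induction h with
  | nil => rfl
  | cons a _ ih => simp [subsetSums, ih]
  | swap a b l =>
    ext x
    simp only [mem_subsetSums_cons]
    rw [sub_right_comm]
    tauto
  | trans _ _ h1 h2 => exact h1.trans h2

theorem subsetSums_mono_of_sublist {l l' : List A} (h : l.Sublist l') :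
    subsetSums l ⊆ subsetSums l' := by
  induction h with
  | slnil => exact subset_rfl
  | cons a _ ih => exact ih.trans Finset.subset_union_left
  | cons_cons a _ ih =>
    intro x
    rw [mem_subsetSums_cons, mem_subsetSums_cons]
    exact Or.imp (@ih _) (@ih _)

theorem subsetSums_mono {l l' : List A} (h : l.Subperm l') : subsetSums l ⊆ subsetSums l' := by
  obtain ⟨l'', hp, hs⟩ := h
  rw [← subsetSums_perm hp]
  exact subsetSums_mono_of_sublist hs

theorem subsetSums_map {B : Type*} [AddCommGroup B] [DecidableEq B] (φ : A →+ B) (l : List A) :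
    subsetSums (l.map φ) = (subsetSums l).image φ := by
  induction l with
  | nil => simp [subsetSums]
  | cons a l ih =>
    simp only [List.map_cons, subsetSums, ih, Finset.image_union, Finset.image_image]
    congr 2
    ext x
    simp

/-- Few terms suffice to obtain all sums of subsequences. -/
theorem exists_sublist_subsetSums_eq {β : Type*} (g : β → A) (l : List β) :
    ∃ t : List β, t.Sublist l ∧ subsetSums (t.map g) = subsetSums (l.map g) ∧
      t.length + 1 ≤ (subsetSums (l.map g)).card := by
  induction l with
  | nil => exact ⟨[], by simp, rfl, by simp [subsetSums]⟩
  | cons b l ih =>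
    obtain ⟨t, ht, he, hc⟩ := ih
    by_cases h : subsetSums ((b :: l).map g) = subsetSums (l.map g)
    · exact ⟨t, ht.cons b, he.trans h.symm, by rw [h]; exact hc⟩
    · refine ⟨b :: t, ht.cons_cons b, by simp [subsetSums, he], ?_⟩
      have : subsetSums (l.map g) ⊂ subsetSums ((b :: l).map g) :=
        (subsetSums_mono_of_sublist (by simp)).ssubset_of_ne (Ne.symm h)
      have := Finset.card_lt_card this
      simp only [List.length_cons]
      omega

theorem subsetSums_subset_cons (a : A) (l : List A) : subsetSums l ⊆ subsetSums (a :: l) :=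
  subsetSums_mono_of_sublist (by simp)

theorem add_mem_subsetSums_cons_of_period {a h : A} {l : List A}
    (hl : ∀ x ∈ subsetSums l, h + x ∈ subsetSums l) {x : A} (hx : x ∈ subsetSums (a :: l)) :
    h + x ∈ subsetSums (a :: l) := by
  rw [mem_subsetSums_cons] at hx ⊢
  refine hx.imp (hl x) fun hx => ?_
  rw [add_sub_assoc]
  exact hl _ hx

/-- If the set of sums of subsequences has no nonzero period, it has at least one element more
than the sequence has nonzero terms. -/
theorem outside_bot_lt_card_subsetSums (l : List A)
    (hl : ∀ h, (∀ x ∈ subsetSums l, h + x ∈ subsetSums l) → h = 0) :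
    outside id ⊥ (l : Multiset A) + 1 ≤ (subsetSums l).card := by
  induction l with
  | nil => simp [subsetSums, outside]
  | cons a l ih =>
    have ih := ih fun h hh => hl h fun x hx => add_mem_subsetSums_cons_of_period hh hx
    by_cases ha : a = 0
    · subst ha
      rw [← Multiset.cons_coe, outside_cons_of_mem (by simp)]
      exact ih.trans (Finset.card_le_card (subsetSums_subset_cons 0 l))
    · rw [← Multiset.cons_coe, outside_cons_of_notMem (by simpa using ha)]
      refine ih.trans_lt (Finset.card_lt_card ((subsetSums_subset_cons a l).ssubset_of_ne ?_))
      -- If the set did not grow, `a` would be a nonzero period.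
      intro he
      refine ha (hl a ?_)
      rw [← he]
      intro x hx
      rw [he, mem_subsetSums_cons]
      right
      simpa using hx

variable [Finite A]

/-- Let `H` be the stabilizer of the set of subset sums. If `H` is trivial, each nonzero term
enlarges the set. If `H` is proper and nontrivial, the image in the quotient has trivial stabilizer,
so it has at least one element more than there are terms outside `H`, hence at least `H.index`
elements. It is then the whole quotient, and the set, being a union of cosets of `H`, is everything.
-/
theorem subsetSums_eq_univ_or [Fintype A] (l : List A)
    (hl : ∀ K : AddSubgroup A, K ≠ ⊥ → K ≠ ⊤ → 
      K.index ≤ outside id K l + 1) :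
    subsetSums l = Finset.univ ∨ outside id ⊥ (l : Multiset A) + 1 ≤ (subsetSums l).card := by
  classical
  let H : AddSubgroup A :=
    { carrier := {h | ∀ x ∈ subsetSums l, h + x ∈ subsetSums l}
      zero_mem' := by simp
      add_mem' := by
        intro a b ha hb x hx
        rw [add_assoc]
        exact ha _ (hb x hx)
      neg_mem' := by
        intro a ha x hx
        have hinj : Set.InjOn (a + ·) (subsetSums l : Set A) :=
          (add_right_injective a).injOn
        obtain ⟨y, hy, hyx⟩ := Finset.surjOn_of_injOn_of_card_le (a + ·)
          (fun x hx => ha x hx) hinj le_rfl hx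
        rw [← hyx]
        simpa using hy }
  have hH : ∀ h, h ∈ H ↔ ∀ x ∈ subsetSums l, h + x ∈ subsetSums l := fun h => Iff.rfl
  by_cases hbot : H = ⊥
  · right
    refine outside_bot_lt_card_subsetSums l fun h hh => ?_
    have : h ∈ H := hh
    rwa [hbot, AddSubgroup.mem_bot] at this
  left
  by_cases htop : H = ⊤
  · refine Finset.eq_univ_iff_forall.2 fun x => ?_
    have : x ∈ H := by rw [htop]; trivial
    simpa using this 0 (zero_mem_subsetSums l)
  have h1 := hl H hbot htop
  have himg := subsetSums_map (QuotientAddGroup.mk' H) l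
  have hper : ∀ x y, x ∈ subsetSums l → QuotientAddGroup.mk' H x = QuotientAddGroup.mk' H y →
      y ∈ subsetSums l := by
    intro x y hx hxy
    have : -x + y ∈ H := by simpa [QuotientAddGroup.eq] using hxy
    have := this x hx
    simpa using this
  have h2 := outside_bot_lt_card_subsetSums (l.map (QuotientAddGroup.mk' H)) (by
    intro h
    obtain ⟨a, rfl⟩ := QuotientAddGroup.mk'_surjective H h
    intro hh
    rw [himg] at hh
    have : a ∈ H := by
      intro x hx
      obtain ⟨y, hy, hyx⟩ := Finset.mem_image.1 (hh _ (Finset.mem_image_of_mem _ hx))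
      exact hper y _ hy (by simpa using hyx)
    simpa using this)
  have h3 : outside id ⊥ ((l.map (QuotientAddGroup.mk' H) : List (A ⧸ H)) : Multiset (A ⧸ H)) =
      outside id H l := by
    rw [← Multiset.map_coe, outside_map]
    unfold outside
    exact Multiset.countP_congr rfl fun x _ => by simp
  rw [h3, himg] at h2
  have : Fintype (A ⧸ H) := Fintype.ofFinite _
  have h4 : H.index = Fintype.card (A ⧸ H) := by
    rw [AddSubgroup.index, Nat.card_eq_fintype_card]
  have h5 : (subsetSums l).image (QuotientAddGroup.mk' H) = Finset.univ := by
    rw [← Finset.card_eq_iff_eq_univ]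
    exact le_antisymm (Finset.card_le_univ _) (by omega)
  refine Finset.eq_univ_iff_forall.2 fun y => ?_
  obtain ⟨x, hx, hxy⟩ := Finset.mem_image.1 (h5 ▸ Finset.mem_univ (QuotientAddGroup.mk' H y))
  exact hper x y hx hxy

end SubsetSums

/-! ### Signed sums in cyclic groups of odd order -/

section SignedSums

variable {β : Type*}

/-- A signed sum plus the full sum is twice the sum of the terms with positive sign. -/
theorem exists_signed_sum_of_mem_subsetSums {A : Type*} [AddCommGroup A] [DecidableEq A]
    (f : β → A) (l : List β) (d : A)
    (h : d + (l.map f).sum ∈ subsetSums (l.map fun b => f b + f b)) :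
    ∃ p q : Multiset β, p + q = l ∧ (p.map f).sum - (q.map f).sum = d := by
  induction l generalizing d with
  | nil =>
    refine ⟨0, 0, by simp, ?_⟩
    simpa [subsetSums, eq_comm] using h
  | cons b l ih =>
    rw [List.map_cons, List.map_cons, mem_subsetSums_cons, List.sum_cons] at h
    rcases h with h | h
    · obtain ⟨p, q, hpq, hd⟩ := ih (d + f b) (by rwa [add_assoc])
      refine ⟨p, b ::ₘ q, by rw [Multiset.add_cons, hpq, Multiset.cons_coe], ?_⟩
      rw [Multiset.map_cons, Multiset.sum_cons, add_comm (f b), ← sub_sub, hd, add_sub_cancel_right]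
    · obtain ⟨p, q, hpq, hd⟩ := ih (d - f b) (by convert h using 1; abel)
      refine ⟨b ::ₘ p, q, by rw [Multiset.cons_add, hpq, Multiset.cons_coe], ?_⟩
      rw [Multiset.map_cons, Multiset.sum_cons, add_sub_assoc, hd, add_sub_cancel]

theorem ZMod.mem_of_add_self_mem {n : ℕ} (hn : Odd n) (K : AddSubgroup (ZMod n)) {x : ZMod n}
    (hx : x + x ∈ K) : x ∈ K := by
  obtain ⟨h, rfl⟩ := hn
  have : x = (h + 1) • (x + x) := by
    have h1 : ((2 * h + 1 : ℕ) : ZMod (2 * h + 1)) = 0 := ZMod.natCast_self _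
    push_cast at h1
    rw [nsmul_eq_mul]
    push_cast
    linear_combination (-x) * h1
  rw [this]
  exact K.nsmul_mem hx _

theorem ZMod.add_self_mem_iff {n : ℕ} (hn : Odd n) (K : AddSubgroup (ZMod n)) {x : ZMod n} :
    x + x ∈ K ↔ x ∈ K :=
  ⟨ZMod.mem_of_add_self_mem hn K, fun h => K.add_mem h h⟩

/-- If enough terms of `V` lie outside of each proper subgroup, some subsequence of given length has
signed sums taking all values, or all nonzero ones. -/
theorem ZMod.exists_le_forall_signed_sum {n : ℕ} [NeZero n] (hn : Odd n) (f : β → ZMod n)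
    (V : Multiset β) {M : ℕ} (hnM : n ≤ M + 1 ∨ M = V.card) (hM : M ≤ V.card)
    (hK : ∀ K : AddSubgroup (ZMod n), K ≠ ⊥ → K ≠ ⊤ → K.index ≤ outside f K V + 1)
    (h0 : n ≤ outside f ⊥ V + 2) :
    ∃ W ≤ V, W.card = M ∧ ∀ d : ZMod n, d ≠ 0 ∨ n ≤ outside f ⊥ V + 1 →
      ∃ p q : Multiset β, p + q = W ∧ (p.map f).sum - (q.map f).sum = d := by
  obtain ⟨l, rfl⟩ : ∃ l : List β, (l : Multiset β) = V := Quot.exists_rep V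
  set g : β → ZMod n := fun b => f b + f b with hg
  have hout : ∀ K, outside id K ((l.map g : List (ZMod n)) : Multiset (ZMod n)) =
      outside f K (l : Multiset β) := by
    intro K
    rw [← Multiset.map_coe, outside_map]
    exact outside_congr fun b _ => ZMod.add_self_mem_iff hn K
  have hX := subsetSums_eq_univ_or (l.map g) (by
    intro K h1 h2
    rw [hout]
    exact hK K h1 h2)
  rw [hout] at hX
  -- At most `n - 1` terms already yield all subset sums; any `W` between these and `l` has the same
  -- set, so its length can be prescribed.
  obtain ⟨T, hT, hTX, hTc⟩ := exists_sublist_subsetSums_eq g l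
  have hTn : T.length + 1 ≤ n := hTc.trans ((Finset.card_le_univ _).trans (ZMod.card n).le)
  obtain ⟨W, hTW, hWl, hWM⟩ := Multiset.exists_between_card_eq (k := M)
    (show (T : Multiset β) ≤ (l : Multiset β) from hT.subperm)
    (by
      have := hT.length_le
      rw [Multiset.coe_card] at hnM ⊢
      omega) hM
  refine ⟨W, hWl, hWM, fun d hd => ?_⟩
  obtain ⟨w, rfl⟩ : ∃ w : List β, (w : Multiset β) = W := Quot.exists_rep W
  have hmap : ∀ l₁ l₂ : List β, (l₁ : Multiset β) ≤ (l₂ : Multiset β) →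
      (l₁.map g).Subperm (l₂.map g) := by
    intro l₁ l₂ h
    have := Multiset.map_le_map (f := g) h
    rwa [Multiset.map_coe, Multiset.map_coe, Multiset.coe_le] at this
  have hwX : subsetSums (w.map g) = subsetSums (l.map g) := by
    refine (subsetSums_mono ?_).antisymm ?_
    · exact hmap _ _ hWl
    · rw [← hTX]
      exact subsetSums_mono (hmap _ _ hTW)
  refine exists_signed_sum_of_mem_subsetSums f w d ?_
  by_contra hmem
  have hsum : (w.map g).sum = (w.map f).sum + (w.map f).sum := by
    rw [hg, List.sum_map_add]
  have hmem' : -d + (w.map f).sum ∉ subsetSums (w.map g) := by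
    intro h
    refine hmem ?_
    convert sum_sub_mem_subsetSums h using 1
    rw [hsum]; abel
  rw [hwX] at hmem hmem'
  rcases hX with hX | hX
  · rw [hX] at hmem
    exact hmem (Finset.mem_univ _)
  rcases hd with hd | hd
  -- The set of signed sums is symmetric and misses at most one residue. A missing `d ≠ 0` would
  -- force `-d ≠ d` to be missing too, as `n` is odd.
  · have hne : d + (w.map f).sum ≠ -d + (w.map f).sum := by
      intro h
      have h2 : d + d = 0 := by
        have := add_right_cancel h
        nth_rw 2 [this]
        abel
      have := ZMod.mem_of_add_self_mem hn ⊥ (x := d) (by simpa using h2)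
      exact hd (by simpa using this)
    have : subsetSums (l.map g) ⊆ ((Finset.univ.erase (d + (w.map f).sum)).erase
        (-d + (w.map f).sum)) := by
      intro x hx
      refine Finset.mem_erase.2 ⟨?_, Finset.mem_erase.2 ⟨?_, Finset.mem_univ _⟩⟩
      · rintro rfl
        exact hmem' hx
      · rintro rfl
        exact hmem hx
    have := Finset.card_le_card this
    rw [Finset.card_erase_of_mem (Finset.mem_erase.2 ⟨hne.symm, Finset.mem_univ _⟩),
      Finset.card_erase_of_mem (Finset.mem_univ _), Finset.card_univ, ZMod.card] at this
    have : 0 < n := Nat.pos_of_ne_zero (NeZero.ne n)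
    have : n ≠ 1 := by
      rintro rfl
      exact hd (Subsingleton.elim _ _)
    omega
  · have : subsetSums (l.map g) = Finset.univ := by
      rw [← Finset.card_eq_iff_eq_univ, ZMod.card]
      refine le_antisymm ((Finset.card_le_univ _).trans (ZMod.card n).le) (by omega)
    rw [this] at hmem
    exact hmem (Finset.mem_univ _)

/-! ### Either-or choices -/

variable {A : Type*} [AddCommGroup A]

/-- The differences available when one term of each pair is chosen, with a sign. -/
def pairGens (f : β → A) (P : List (β × β)) : List A :=
  P.flatMap fun p => [f p.1 + f p.2, f p.1 - f p.2]

theorem pairGens_cons (f : β → A) (p : β × β) (P : List (β × β)) :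
    pairGens f (p :: P) = (f p.1 + f p.2) :: (f p.1 - f p.2) :: pairGens f P := rfl

/-- Starting from `-f a`, adding a subset sum of `f a + f b` and `f a - f b` gives exactly `-f a`,
`f b`, `-f b`, `f a`: one term of the pair with either sign. Thus choosing within pairs is again a
subset sum problem. -/
theorem exists_signed_sum_of_mem_subsetSums_pairGens [DecidableEq A] (f : β → A)
    (P : List (β × β)) (l : List β) (d : A)
    (h : d + (P.map fun p => f p.1).sum + (l.map f).sum ∈
      subsetSums (pairGens f P ++ l.map fun b => f b + f b)) :
    ∃ p q : Multiset β, p + q ≤ (P.map Prod.fst : List β) + (P.map Prod.snd : List β) +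
        (l : Multiset β) ∧ (p + q).card = P.length + l.length ∧
        (p.map f).sum - (q.map f).sum = d := by
  classical
  induction P generalizing d with
  | nil =>
    obtain ⟨p, q, hpq, hd⟩ := exists_signed_sum_of_mem_subsetSums f l d (by
      simpa [pairGens] using h)
    exact ⟨p, q, by simp [hpq], by simp [hpq], hd⟩
  | cons x P ih =>
    obtain ⟨a, b⟩ := x
    rw [pairGens_cons, List.cons_append, List.cons_append, mem_subsetSums_cons,
      mem_subsetSums_cons, mem_subsetSums_cons] at h
    have key : ∀ c, c = a ∨ c = b → ∀ p q : Multiset β,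
        p + q ≤ (P.map Prod.fst : List β) + (P.map Prod.snd : List β) + (l : Multiset β) →
        c ::ₘ (p + q) ≤ (((a, b) :: P).map Prod.fst : List β) +
          (((a, b) :: P).map Prod.snd : List β) + (l : Multiset β) := by
      intro c hc p q hpq
      simp only [List.map_cons, ← Multiset.cons_coe, Multiset.cons_add, Multiset.add_cons]
      rcases hc with rfl | rfl
      · rw [Multiset.cons_swap]
        exact (Multiset.cons_le_cons _ hpq).trans (Multiset.le_cons_self _ _) |>.trans_eq (by
          rw [Multiset.cons_swap])
      · exact (Multiset.cons_le_cons _ hpq).trans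
          ((Multiset.le_cons_self _ _).trans_eq (by rw [Multiset.cons_swap]))
    simp only [List.map_cons, List.sum_cons] at h
    have plus : ∀ c, c = a ∨ c = b → (d - f c) + (P.map fun p => f p.1).sum + (l.map f).sum ∈
        subsetSums (pairGens f P ++ l.map fun b => f b + f b) → ∃ p q : Multiset β,
        p + q ≤ (((a, b) :: P).map Prod.fst : List β) +
          (((a, b) :: P).map Prod.snd : List β) + (l : Multiset β) ∧
        (p + q).card = ((a, b) :: P).length + l.length ∧
          (p.map f).sum - (q.map f).sum = d := by
      intro c hc h
      obtain ⟨p, q, hpq, hc', hd⟩ := ih _ h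
      refine ⟨c ::ₘ p, q, ?_, ?_, ?_⟩
      · rw [Multiset.cons_add]; exact key c hc p q hpq
      · rw [Multiset.cons_add, Multiset.card_cons, hc', List.length_cons]; ring
      · rw [Multiset.map_cons, Multiset.sum_cons, add_sub_assoc, hd, add_sub_cancel]
    have minus : ∀ c, c = a ∨ c = b → (d + f c) + (P.map fun p => f p.1).sum + (l.map f).sum ∈
        subsetSums (pairGens f P ++ l.map fun b => f b + f b) → ∃ p q : Multiset β,
        p + q ≤ (((a, b) :: P).map Prod.fst : List β) +
          (((a, b) :: P).map Prod.snd : List β) + (l : Multiset β) ∧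
        (p + q).card = ((a, b) :: P).length + l.length ∧
          (p.map f).sum - (q.map f).sum = d := by
      intro c hc h
      obtain ⟨p, q, hpq, hc', hd⟩ := ih _ h
      refine ⟨p, c ::ₘ q, ?_, ?_, ?_⟩
      · rw [Multiset.add_cons]; exact key c hc p q hpq
      · rw [Multiset.add_cons, Multiset.card_cons, hc', List.length_cons]; ring
      · rw [Multiset.map_cons, Multiset.sum_cons, add_comm (f c), ← sub_sub, hd,
          add_sub_cancel_right]
    rcases h with (h | h) | (h | h)
    · exact minus a (Or.inl rfl) (by convert h using 1; abel)
    · exact minus b (Or.inr rfl) (by convert h using 1; abel)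
    · exact plus b (Or.inr rfl) (by convert h using 1; abel)
    · exact plus a (Or.inl rfl) (by convert h using 1; abel)

theorem outside_coe_cons_add (a : A) (K : AddSubgroup A) (l : List A) :
    outside id K ((a :: l : List A) : Multiset A) =
      outside id K ({a} : Multiset A) + outside id K (l : Multiset A) := by
  rw [← outside_add, Multiset.singleton_add, Multiset.cons_coe]

theorem outside_singleton_of_mem {f : β → A} {K : AddSubgroup A} {b : β} (hb : f b ∈ K) :
    outside f K {b} = 0 := by
  rw [← Multiset.cons_zero, outside_cons_of_mem hb, outside_zero]

theorem outside_singleton_of_notMem {f : β → A} {K : AddSubgroup A} {b : β} (hb : f b ∉ K) :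
    outside f K {b} = 1 := by
  rw [← Multiset.cons_zero, outside_cons_of_notMem hb, outside_zero]

theorem outside_singleton_eq (f : β → A) (K : AddSubgroup A) (b : β) :
    (f b ∈ K ∧ outside f K {b} = 0) ∨ (f b ∉ K ∧ outside f K {b} = 1) := by
  by_cases hx : f b ∈ K
  · exact Or.inl ⟨hx, outside_singleton_of_mem hx⟩
  · exact Or.inr ⟨hx, outside_singleton_of_notMem hx⟩

/-- If sum and difference lie in `K`, so do the doubles and hence, in odd order, both terms. If only
one term lies in `K`, sum and difference are both outside, which is the gain in the last clause. -/
theorem outside_pair_le {n : ℕ} (hn : Odd n) (f : β → ZMod n) (K : AddSubgroup (ZMod n)) (a b : β) :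
    outside f K {a} ≤ outside id K {f a + f b} + outside id K {f a - f b} ∧
    outside f K {b} ≤ outside id K {f a + f b} + outside id K {f a - f b} ∧
    (f b ∈ K → 2 * outside f K {a} ≤ outside id K {f a + f b} + outside id K {f a - f b}) := by
  have ep := outside_singleton_eq id K (f a + f b)
  have em := outside_singleton_eq id K (f a - f b)
  simp only [id] at ep em
  by_cases ha : f a ∈ K <;> by_cases hb : f b ∈ K
  · rw [outside_singleton_of_mem ha, outside_singleton_of_mem hb]
    omega
  · have hp : f a + f b ∉ K := fun h => hb (by simpa using K.sub_mem h ha)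
    rw [outside_singleton_of_mem ha, outside_singleton_of_notMem hb]
    have : outside id K {f a + f b} = 1 := outside_singleton_of_notMem (f := id) hp
    omega
  · have hp : f a + f b ∉ K := fun h => ha (by simpa using K.sub_mem h hb)
    have hm : f a - f b ∉ K := fun h => ha (by simpa using K.add_mem h hb)
    rw [outside_singleton_of_notMem ha, outside_singleton_of_mem hb]
    have : outside id K {f a + f b} = 1 := outside_singleton_of_notMem (f := id) hp
    have : outside id K {f a - f b} = 1 := outside_singleton_of_notMem (f := id) hm
    omega
  · have h1 : f a + f b ∉ K ∨ f a - f b ∉ K := by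
      by_contra! h
      exact ha (ZMod.mem_of_add_self_mem hn K (by convert K.add_mem h.1 h.2 using 1; abel))
    rw [outside_singleton_of_notMem ha, outside_singleton_of_notMem hb]
    refine ⟨?_, ?_, fun h => absurd h hb⟩ <;>
    · rcases h1 with h1 | h1
      · have : outside id K {f a + f b} = 1 := outside_singleton_of_notMem (f := id) h1
        omega
      · have : outside id K {f a - f b} = 1 := outside_singleton_of_notMem (f := id) h1
        omega

theorem outside_pairGens {n : ℕ} (hn : Odd n) (f : β → ZMod n) (K : AddSubgroup (ZMod n))
    (P : List (β × β)) :
    outside f K (P.map Prod.fst : List β) ≤ outside id K (pairGens f P : Multiset (ZMod n)) ∧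
    outside f K (P.map Prod.fst : List β) + outside f K (P.map Prod.snd : List β) ≤
      2 * outside id K (pairGens f P : Multiset (ZMod n)) ∧
    ((∀ p ∈ P, f p.2 ∈ K) → 2 * outside f K (P.map Prod.fst : List β) ≤
      outside id K (pairGens f P : Multiset (ZMod n))) := by
  induction P with
  | nil => simp [pairGens, outside_zero]
  | cons x P ih =>
    obtain ⟨a, b⟩ := x
    obtain ⟨i1, i2, i3⟩ := ih
    obtain ⟨h1, h2, h3⟩ := outside_pair_le hn f K a b
    have ec : ∀ (x : β) (l : List β), outside f K ((x :: l : List β) : Multiset β) =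
        outside f K {x} + outside f K (l : Multiset β) := by
      intro x l
      rw [← outside_add, Multiset.singleton_add, Multiset.cons_coe]
    rw [pairGens_cons, List.map_cons, List.map_cons, ec, ec, outside_coe_cons_add,
      outside_coe_cons_add]
    dsimp only at *
    refine ⟨by omega, by omega, fun h => ?_⟩
    have := h3 (h (a, b) (by simp))
    have := i3 fun p hp => h p (by simp [hp])
    omega

/-- A cyclic group has at most three solutions of `3 • x = 0`, and `K` supplies three. -/
theorem ZMod.mem_iff_three_nsmul_eq_zero {n : ℕ} [NeZero n] {K : AddSubgroup (ZMod n)}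
    (hK : Nat.card K = 3) (x : ZMod n) : x ∈ K ↔ 3 • x = 0 := by
  classical
  have h1 : ∀ x ∈ K, 3 • x = 0 := by
    intro x hx
    have : Nat.card K • (⟨x, hx⟩ : K) = 0 := card_nsmul_eq_zero'
    rw [hK] at this
    simpa using congrArg Subtype.val this
  refine ⟨h1 x, fun hx => ?_⟩
  have h2 := IsAddCyclic.card_nsmul_eq_zero_le (α := ZMod n) (n := 3) (by norm_num)
  have h3 : Finset.univ.filter (· ∈ K) = Finset.univ.filter fun x : ZMod n => 3 • x = 0 := by
    refine Finset.eq_of_subset_of_card_le (fun y hy => ?_) ?_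
    · simp only [Finset.mem_filter, Finset.mem_univ, true_and] at hy ⊢
      exact h1 y hy
    · refine h2.trans ?_
      rw [← hK, Nat.card_eq_fintype_card, Fintype.card_subtype]
  have := Finset.ext_iff.1 h3 x
  have hx' : 3 * x = 0 := by simpa using hx
  simpa [hx'] using this

end SignedSums

/-- A sequence of `3 h` terms over the cyclic group of order `n = 2 h + 1` has `n` terms of sum
zero, unless all elements are signed sums of `2 h` of its terms. -/
theorem ZMod.sum_eq_zero_or_forall_signed_sum {β : Type*} {h n : ℕ} [NeZero n] (hn : n = 2 * h + 1)
    (f : β → ZMod n) (V : Multiset β) (hV : V.card = 3 * h) :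
    (∃ t ≤ V, t.card = n ∧ (t.map f).sum = 0) ∨
      ∀ d : ZMod n, ∃ p q : Multiset β, p + q ≤ V ∧ (p + q).card = 2 * h ∧
        (p.map f).sum - (q.map f).sum = d := by
  classical
  have hodd : Odd n := ⟨h, hn⟩
  rw [or_iff_not_imp_left]
  intro hno
  -- Otherwise at least `n + Nat.card K - 1` terms lie in `K`, and Erdős–Ginzburg–Ziv in `K` gives
  -- `n` terms of sum zero.
  have hcount : ∀ K : AddSubgroup (ZMod n), h + 1 ≤ outside f K V + Nat.card K := by
    intro K
    by_contra hK
    obtain ⟨W, hW, hWK, hWc⟩ := exists_inside f K V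
    obtain ⟨t, ht, htc, ht0⟩ := ZMod.exists_le_card_eq_sum_eq_zero_of_mem f K (M := n)
      (by simpa using K.card_addSubgroup_dvd_card) W hWK (by omega)
    exact hno ⟨t, ht.trans hW, htc, ht0⟩
  -- sort by the distance from zero in the chain of the subgroups of order `3` and `1`
  let key : β → ℕ := fun b => if 3 • f b = 0 then (if f b = 0 then 2 else 1) else 0
  obtain ⟨l, hl, hsort⟩ : ∃ l : List β, (l : Multiset β) = V ∧
      l.Pairwise (fun a b => key a ≤ key b) := by
    obtain ⟨l, rfl⟩ : ∃ l : List β, (l : Multiset β) = V := Quot.exists_rep V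
    refine ⟨l.mergeSort (fun a b => key a ≤ key b),
      Multiset.coe_eq_coe.2 (List.mergeSort_perm _ _), ?_⟩
    have := List.pairwise_mergeSort (le := fun a b => decide (key a ≤ key b))
      (fun a b c hab hbc => by simp only [decide_eq_true_eq] at *; omega)
      (fun a b => by simp only [Bool.or_eq_true, decide_eq_true_eq]; omega) l
    simpa using this
  obtain ⟨top, mid, bot, rfl, htop, hmid, hbot⟩ : ∃ top mid bot : List β,
      l = top ++ (mid ++ bot) ∧ top.length = h ∧ mid.length = h ∧ bot.length = h := by
    have hlen : l.length = 3 * h := by rw [← Multiset.coe_card, hl, hV]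
    refine ⟨l.take h, (l.drop h).take h, (l.drop h).drop h, by simp, ?_, ?_, ?_⟩ <;>
      simp <;> omega
  rw [List.pairwise_append, List.pairwise_append] at hsort
  obtain ⟨-, ⟨-, -, hmb⟩, htmb⟩ := hsort
  -- One term is used from each of the `h` pairs, and all `h` terms of `mid`: this makes `2 * h`.
  -- Pairing the first terms of the order with the last makes a pair likely to have only one term
  -- outside a small subgroup, and then it yields two generators outside.
  set P := top.zip bot with hP
  have hfst : P.map Prod.fst = top := List.map_fst_zip (by omega)
  have hsnd : P.map Prod.snd = bot := List.map_snd_zip (by omega)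
  have hVsum : ∀ K, outside f K V = outside f K (top : Multiset β) +
      outside f K (mid : Multiset β) + outside f K (bot : Multiset β) := by
    intro K
    rw [← hl, ← Multiset.coe_add, ← Multiset.coe_add, outside_add, outside_add, add_assoc]
  have hgens : ∀ K, outside id K
      ((pairGens f P ++ mid.map fun b => f b + f b : List (ZMod n)) : Multiset (ZMod n)) =
      outside id K (pairGens f P : Multiset (ZMod n)) + outside f K (mid : Multiset β) := by
    intro K
    rw [← Multiset.coe_add, outside_add, ← Multiset.map_coe, outside_map]
    congr 1
    exact outside_congr fun b _ => ZMod.add_self_mem_iff hodd K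
  have hind : ∀ K : AddSubgroup (ZMod n), K.index * Nat.card K = n := by
    intro K
    rw [mul_comm]
    simpa using K.card_mul_index
  have hmain : ∀ K : AddSubgroup (ZMod n), K ≠ ⊤ → K.index ≤ outside id K
      ((pairGens f P ++ mid.map fun b => f b + f b : List (ZMod n)) : Multiset (ZMod n)) + 1 := by
    intro K hK
    rw [hgens]
    obtain ⟨g1, g2, g3⟩ := outside_pairGens hodd f K P
    rw [hfst] at g1 g2 g3
    rw [hsnd] at g2
    have hc := hcount K
    rw [hVsum] at hc
    have hi := hind K
    have hle : outside f K (bot : Multiset β) ≤ h := by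
      rw [← hbot]; exact Multiset.countP_le_card _ _
    set j := K.index
    set k := Nat.card K with hk
    have hj1 : j ≠ 1 := fun hj => hK (AddSubgroup.index_eq_one.1 hj)
    have hkodd : Odd k := (Nat.odd_mul.1 (hi ▸ hodd)).2
    have hjodd : Odd j := (Nat.odd_mul.1 (hi ▸ hodd)).1
    have hj3 : 3 ≤ j := by
      obtain ⟨u, hu⟩ := hjodd
      omega
    -- For subgroups of order 1 and 3, the terms outside form an initial segment of the sorted list;
    -- the cases are whether it reaches `bot`, ends in `mid`, or stays in `top`.
    have chain : (∃ N, ∀ b, f b ∉ K ↔ key b < N) → k ≤ 3 → j ≤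
        outside id K (pairGens f P : Multiset (ZMod n)) + outside f K (mid : Multiset β) + 1 := by
      rintro ⟨N, hN⟩ hk3
      have hjn : j ≤ n := by
        rw [← hi]
        exact Nat.le_mul_of_pos_right _ (by obtain ⟨u, hu⟩ := hkodd; omega)
      by_cases hb : ∃ b ∈ bot, f b ∉ K
      · obtain ⟨b, hb, hbK⟩ := hb
        have e1 : outside f K (top : Multiset β) = h := by
          rw [← htop, ← Multiset.coe_card]
          refine outside_eq_card fun a ha => ?_
          rw [hN] at hbK ⊢
          exact (htmb a ha b (by simp [hb])).trans_lt hbK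
        have e2 : outside f K (mid : Multiset β) = h := by
          rw [← hmid, ← Multiset.coe_card]
          refine outside_eq_card fun a ha => ?_
          rw [hN] at hbK ⊢
          exact (hmb a ha b hb).trans_lt hbK
        omega
      · push Not at hb
        have e3 : 2 * outside f K (top : Multiset β) ≤
            outside id K (pairGens f P : Multiset (ZMod n)) := by
          refine g3 fun p hp => hb _ ?_
          rw [← hsnd]
          exact List.mem_map_of_mem hp
        by_cases hm : ∃ b ∈ mid, f b ∉ K
        · obtain ⟨b, hb, hbK⟩ := hm
          have e1 : outside f K (top : Multiset β) = h := by
            rw [← htop, ← Multiset.coe_card]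
            refine outside_eq_card fun a ha => ?_
            rw [hN] at hbK ⊢
            exact (htmb a ha b (by simp [hb])).trans_lt hbK
          omega
        · push Not at hm
          have e1 : outside f K (mid : Multiset β) = 0 := outside_eq_zero hm
          have e2 : outside f K (bot : Multiset β) = 0 := outside_eq_zero hb
          have : k = 1 ∨ k = 3 := by
            obtain ⟨u, hu⟩ := hkodd
            omega
          rcases this with hk' | hk' <;> rw [hk'] at hi hc <;> omega
    rcases (by obtain ⟨u, hu⟩ := hkodd; omega : k = 1 ∨ k = 3 ∨ 5 ≤ k) with hk' | hk' | hk'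
    · refine chain ⟨2, fun b => ?_⟩ (by omega)
      rw [AddSubgroup.eq_bot_of_card_eq K hk', AddSubgroup.mem_bot]
      by_cases h0 : f b = 0
      · simp [key, h0]
      · simp only [h0, not_false_eq_true, key, if_false, true_iff]
        split_ifs <;> omega
    · refine chain ⟨1, fun b => ?_⟩ (by omega)
      rw [ZMod.mem_iff_three_nsmul_eq_zero hk']
      simp only [key]
      split_ifs <;> simp_all
    -- For `k ≥ 5` half of the terms outside suffices: failure would give `(j - 2) * (k - 4) < 0`.
    · by_contra hlt
      obtain ⟨j', hj'⟩ : ∃ j', j = j' + 2 := ⟨j - 2, by omega⟩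
      obtain ⟨k', hk''⟩ : ∃ k', k = k' + 4 := ⟨k - 4, by omega⟩
      rw [hj', hk''] at hi
      have : (j' + 2) * (k' + 4) = j' * k' + 4 * j' + 2 * k' + 8 := by ring
      omega
  have huniv : subsetSums (pairGens f P ++ mid.map fun b => f b + f b) = Finset.univ := by
    rcases subsetSums_eq_univ_or (pairGens f P ++ mid.map fun b => f b + f b)
      (fun K _ hK => hmain K hK) with hu | hu
    · exact hu
    · by_cases hbt : (⊥ : AddSubgroup (ZMod n)) = ⊤
      · rw [← Finset.card_eq_iff_eq_univ, ZMod.card]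
        have h1 := Finset.card_pos.2 ⟨_, zero_mem_subsetSums
          (pairGens f P ++ mid.map fun b => f b + f b)⟩
        have h2 : (⊥ : AddSubgroup (ZMod n)).index = 1 := by rw [hbt, AddSubgroup.index_top]
        rw [AddSubgroup.index_bot, Nat.card_zmod] at h2
        have := Finset.card_le_univ (subsetSums (pairGens f P ++ mid.map fun b => f b + f b))
        rw [ZMod.card] at this
        omega
      · have h2 := hmain ⊥ hbt
        rw [AddSubgroup.index_bot, Nat.card_zmod] at h2
        rw [← Finset.card_eq_iff_eq_univ, ZMod.card]
        exact le_antisymm ((Finset.card_le_univ _).trans (ZMod.card n).le) (h2.trans hu)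
  intro d
  obtain ⟨p, q, hpq, hc, hd⟩ := exists_signed_sum_of_mem_subsetSums_pairGens f P mid d
    (huniv ▸ Finset.mem_univ _)
  refine ⟨p, q, ?_, ?_, hd⟩
  · rw [hfst, hsnd] at hpq
    refine hpq.trans_eq ?_
    rw [← hl, ← Multiset.coe_add, ← Multiset.coe_add]
    abel
  · have : P.length = h := by rw [← hfst, List.length_map] at htop; exact htop
    omega

/-! ### Dihedral groups of twice odd order -/

theorem Multiset.card_le_of_nodup_map {G κ : Type*} [Fintype κ] {f : G → κ} {L : Multiset G}
    (h : (L.map f).Nodup) : L.card ≤ Fintype.card κ := by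
  classical
  rw [← Multiset.card_map f L, ← Multiset.toFinset_card_of_nodup h]
  exact Finset.card_le_univ _

theorem Multiset.card_sum_pairs {G : Type*} {V : Multiset (Multiset G)}
    (h : ∀ b ∈ V, ∃ g h, b = ({g} + {h} : Multiset G)) : ∀ b ∈ V, b.card = 2 := by
  intro b hb
  obtain ⟨g, h, rfl⟩ := h b hb
  simp

namespace DihedralRep

variable {G : Type*} [Group G] {m : ℕ} {c : ZMod m} (D : DihedralRep G m c)

/-- Elements can be grouped into pairs whose products are rotations, leaving over at most two
elements. -/
theorem exists_pairing (S : Multiset G) :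
    ∃ (V : Multiset (Multiset G)) (v : Multiset G → ZMod m), V.sum ≤ S ∧
      S.card ≤ 2 * V.card + 2 ∧ ∀ b ∈ V, b.card = 2 ∧ OrderedProd b (D.rot (v b)) := by
  classical
  obtain ⟨V, L, hVL, hV, hL⟩ := Multiset.exists_pairing (fun g => decide (∃ i, g = D.rot i)) S
  have hV2 := Multiset.card_sum_pairs (V := V) fun b hb => by
    obtain ⟨g, h, hb, -⟩ := hV b hb
    exact ⟨g, h, hb⟩
  have hv : ∀ b ∈ V, ∃ i, OrderedProd b (D.rot i) := by
    intro b hb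
    obtain ⟨g, h, rfl, hgh⟩ := hV b hb
    simp only [decide_eq_decide] at hgh
    rcases D.eq_rot_or_eq_ref g with ⟨i, rfl⟩ | ⟨i, rfl⟩ <;>
      rcases D.eq_rot_or_eq_ref h with ⟨j, rfl⟩ | ⟨j, rfl⟩
    · exact ⟨_, D.orderedProd_rot_pair i j⟩
    · obtain ⟨k, hk⟩ := hgh.1 ⟨i, rfl⟩
      exact absurd hk.symm (D.rot_ne_ref _ _)
    · obtain ⟨k, hk⟩ := hgh.2 ⟨j, rfl⟩
      exact absurd hk.symm (D.rot_ne_ref _ _)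
    · exact ⟨_, D.orderedProd_ref_pair i j⟩
  choose! v hv using hv
  refine ⟨V, v, ?_, ?_, fun b hb => ⟨hV2 b hb, hv b hb⟩⟩
  · rw [← hVL]
    exact Multiset.le_add_right _ _
  · have := Multiset.card_le_of_nodup_map hL
    rw [← hVL, Multiset.card_add, Multiset.card_sum_of_forall hV2]
    simp only [Fintype.card_bool] at this
    omega

/-- With at most one reflection, Erdős–Ginzburg–Ziv is used on the rotations. Otherwise two
reflections are set aside, and the other `6 * h + 1` terms contain `3 * h` pairs with rotation
products. Either `n` pairs have product one, or some signed product of `2 * h` pairs cancels the two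
reflections. -/
theorem hasProductOne_of_odd {n : ℕ} (hn : Odd n) (D : DihedralRep G n 0) (S : Multiset G)
    (hS : 3 * n ≤ S.card) : HasProductOne S (2 * n) := by
  obtain ⟨h, hnh⟩ := hn
  have : NeZero n := ⟨by omega⟩
  obtain ⟨S₀, hS₀, hc⟩ := Multiset.exists_le_card_eq' S hS
  refine HasProductOne.mono ?_ hS₀
  clear hS hS₀ S
  obtain ⟨R, Y, rfl⟩ := D.exists_eq_map_add_map S₀
  rw [Multiset.card_add, Multiset.card_map, Multiset.card_map] at hc
  rcases le_or_gt Y.card 1 with hY | hY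
  · obtain ⟨t, ht, htc, ht0⟩ := ZMod.exists_le_card_eq_sum_eq_zero id 2 R (by omega)
    rw [Multiset.map_id] at ht0
    exact hasProductOne_of_rot
      ((Multiset.map_le_map ht).trans (Multiset.le_add_right _ _)) ht0 (by omega)
  obtain ⟨y, Y, rfl⟩ : ∃ y Y', Y = y ::ₘ Y' := by
    obtain ⟨y, hy⟩ := Multiset.card_pos_iff_exists_mem.1 (by omega : 0 < Y.card)
    exact ⟨y, Multiset.exists_cons_of_mem hy⟩
  rw [Multiset.card_cons] at hY
  obtain ⟨z, Y, rfl⟩ : ∃ y Y', Y = y ::ₘ Y' := by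
    obtain ⟨y, hy⟩ := Multiset.card_pos_iff_exists_mem.1 (by omega : 0 < Y.card)
    exact ⟨y, Multiset.exists_cons_of_mem hy⟩
  obtain ⟨V, v, hVS, hVc, hV⟩ := D.exists_pairing (R.map D.rot + Y.map D.ref)
  rw [Multiset.card_cons, Multiset.card_cons] at hc
  rw [Multiset.card_add, Multiset.card_map, Multiset.card_map] at hVc
  obtain ⟨W, hWV, hW⟩ := Multiset.exists_le_card_eq' V (k := 3 * h) (by omega)
  have hWS : W.sum ≤ R.map D.rot + Y.map D.ref := (Multiset.sum_le_sum_of_le hWV).trans hVS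
  have hS : R.map D.rot + (y ::ₘ z ::ₘ Y).map D.ref =
      R.map D.rot + Y.map D.ref + ({D.ref y} + {D.ref z}) := by
    rw [Multiset.map_cons, Multiset.map_cons, ← Multiset.singleton_add, ← Multiset.singleton_add]
    abel
  rw [hS]
  rcases ZMod.sum_eq_zero_or_forall_signed_sum hnh v W hW with ⟨t, ht, htc, ht0⟩ | hd
  · exact hasProductOne_of_sum_eq_zero (v := v)
      (fun b hb => (hV b (Multiset.mem_of_le (ht.trans hWV) hb)).2)
      (((Multiset.sum_le_sum_of_le ht).trans hWS).trans (Multiset.le_add_right _ _)) ht0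
      (fun b hb => (hV b (Multiset.mem_of_le (ht.trans hWV) hb)).1) (by omega)
  · obtain ⟨p, q, hpq, hc', hd⟩ := hd (-(0 + z - y))
    have hmem : ∀ b ∈ p + q, b ∈ V := fun b hb => Multiset.mem_of_le (hpq.trans hWV) hb
    refine hasProductOne_of_twisted (D.twisted_sum_sub (v := v) fun b hb =>
      .of_orderedProd (hV b (hmem b hb)).2) (y := y) (z := z) ?_ (by rw [hd]; abel) ?_
    · gcongr
      exact (Multiset.sum_le_sum_of_le hpq).trans hWS
    · rw [Multiset.card_sum_of_forall fun b hb => (hV b (hmem b hb)).1, hc']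
      omega

end DihedralRep

/-! ### Lifting from quotients with cyclic kernel -/

section Lift

variable {G H : Type*} [Group G] [Group H]

theorem HasProductOne.exists_of_map (φ : G →* H) {S : Multiset G} {e : ℕ}
    (h : HasProductOne (S.map φ) e) : ∃ T ≤ S, T.card = e ∧ ∃ g, φ g = 1 ∧ OrderedProd T g := by
  obtain ⟨T', hT', rfl, l, rfl, hl⟩ := h
  obtain ⟨T, hT, hTl⟩ := Multiset.exists_map_eq_of_le_map hT'
  have key : ∀ (l : List H) (T : Multiset G), T.map φ = l →
      ∃ g, φ g = l.prod ∧ OrderedProd T g := by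
    classical
    intro l
    induction l with
    | nil =>
      intro T hT
      rw [Multiset.coe_nil, Multiset.map_eq_zero] at hT
      exact ⟨1, by simp, hT ▸ .zero⟩
    | cons a l ih =>
      intro T hT
      rw [← Multiset.cons_coe, ← Multiset.map_eq_cons] at hT
      obtain ⟨b, hb, rfl, hT⟩ := hT
      obtain ⟨g, hg, hTg⟩ := ih _ hT
      refine ⟨b * g, by simp [hg], ?_⟩
      rw [← Multiset.cons_erase hb, ← Multiset.singleton_add]
      exact (OrderedProd.singleton b).add hTg
  obtain ⟨g, hg, hTg⟩ := key l T hTl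
  exact ⟨T, hT, by rw [← hTl, Multiset.card_map], g, by rw [hg, hl], hTg⟩

/-- Extract `2 * k - 1` disjoint blocks of length `q` with product in the kernel; Erdős–Ginzburg–Ziv
in `ZMod k` selects `k` of them. The length is just enough, since `2 * q` terms remain after `2 * k
- 2` blocks. -/
theorem hasProductOne_of_quotient (φ : G →* H) {k q : ℕ} (hk : k ≠ 0) (ψ : ZMod k → G)
    (h0 : ψ 0 = 1) (hadd : ∀ i j, ψ i * ψ j = ψ (i + j)) (hker : ∀ g, φ g = 1 → ∃ i, g = ψ i)
    (hH : ∀ S : Multiset H, 2 * q ≤ S.card → HasProductOne S q) (S : Multiset G)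
    (hS : 2 * (q * k) ≤ S.card) : HasProductOne S (q * k) := by
  obtain ⟨V, hV, hVc, hVP⟩ := Multiset.exists_blocks (s := 2 * q) (q := q)
    (P := fun T : Multiset G => ∃ i, OrderedProd T (ψ i)) (by
      intro S hS
      obtain ⟨T, hT, hc, g, hg, hTg⟩ := HasProductOne.exists_of_map φ
        (hH (S.map φ) (by rwa [Multiset.card_map]))
      obtain ⟨i, rfl⟩ := hker g hg
      exact ⟨T, hT, hc, i, hTg⟩) (2 * k - 1) S (by
      obtain ⟨k, rfl⟩ := Nat.exists_eq_succ_of_ne_zero hk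
      have : 2 * (k + 1) - 1 = 2 * k + 1 := by omega
      rw [Nat.succ_eq_add_one, this]
      have : 2 * (q * (k + 1)) = q * (2 * k + 1) + q := by ring
      rw [Nat.succ_eq_add_one] at hS
      omega)
  choose! v hv using fun b hb => (hVP b hb).2
  obtain ⟨t, ht, htc, ht0⟩ := ZMod.exists_le_card_eq_sum_eq_zero v 1 V (by omega)
  refine ⟨t.sum, (Multiset.sum_le_sum_of_le ht).trans hV, ?_, ?_⟩
  · rw [Multiset.card_sum_of_forall fun b hb => (hVP b (Multiset.mem_of_le ht hb)).1, htc]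
    ring
  · have := OrderedProd.sum h0 hadd fun b hb => hv b (Multiset.mem_of_le ht hb)
    rwa [ht0, h0] at this

end Lift

/-! ### Reduction of residues modulo `2 * h` -/

namespace ZMod

/-- Reduction of residues modulo `2 * h` modulo `2`. -/
abbrev parity (h : ℕ) : ZMod (2 * h) →+* ZMod 2 := ZMod.castHom (dvd_mul_right 2 h) (ZMod 2)

/-- Reduction of residues modulo `2 * h` modulo `h`. -/
abbrev reduce (h : ℕ) : ZMod (2 * h) →+* ZMod h := ZMod.castHom (dvd_mul_left h 2) (ZMod h)

theorem eq_zero_of_parity_of_reduce {h : ℕ} (hh : Odd h) {x : ZMod (2 * h)}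
    (h1 : parity h x = 0) (h2 : reduce h x = 0) : x = 0 := by
  have : NeZero (2 * h) := ⟨by obtain ⟨k, rfl⟩ := hh; omega⟩
  rw [← ZMod.natCast_zmod_val x] at h1 h2 ⊢
  rw [map_natCast, ZMod.natCast_eq_zero_iff] at h1 h2
  rw [ZMod.natCast_eq_zero_iff]
  exact Nat.Coprime.mul_dvd_of_dvd_of_dvd (Nat.coprime_two_left.2 hh) h1 h2

theorem card_ker_parity {h : ℕ} (hh : h ≠ 0) :
    Nat.card (parity h).toAddMonoidHom.ker = h := by
  have : NeZero (2 * h) := ⟨by omega⟩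
  have h1 := (parity h).toAddMonoidHom.ker.card_mul_index
  rw [AddSubgroup.index_ker, AddMonoidHom.range_eq_top.2 (ZMod.ringHom_surjective (parity h)),
    AddSubgroup.card_top, Nat.card_zmod, Nat.card_zmod] at h1
  omega

end ZMod

/-! ### Pairs of equal parity -/

namespace DihedralRep

section Index

variable {G : Type*} [Group G] {m : ℕ} {c : ZMod m} (D : DihedralRep G m c)

theorem ref_injective : Function.Injective D.ref := by
  intro i j hij
  have h : ∀ i, D.ref i = D.rot (-i) * D.ref 0 := fun i => by rw [D.rot_mul_ref]; simp
  rw [h i, h j] at hij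
  simpa using D.rot_injective (mul_right_cancel hij)

open Classical in
/-- The exponent of an element, both for rotations and for the elements of the other coset. -/
noncomputable def idx (g : G) : ZMod m :=
  if h : ∃ i, g = D.rot i then h.choose
  else ((D.eq_rot_or_eq_ref g).resolve_left h).choose

theorem idx_rot (i : ZMod m) : D.idx (D.rot i) = i := by
  have h : ∃ j, D.rot i = D.rot j := ⟨i, rfl⟩
  rw [idx, dif_pos h]
  exact (D.rot_injective h.choose_spec).symm

theorem idx_ref (i : ZMod m) : D.idx (D.ref i) = i := by
  have h : ¬ ∃ j, D.ref i = D.rot j := fun ⟨j, hj⟩ => D.rot_ne_ref j i hj.symm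
  rw [idx, dif_neg h]
  exact (D.ref_injective ((D.eq_rot_or_eq_ref (D.ref i)).resolve_left h).choose_spec).symm

/-- Whether an element is a rotation. -/
noncomputable def isRot (g : G) : Bool := by
  classical exact decide (∃ i, g = D.rot i)

theorem isRot_rot (i : ZMod m) : D.isRot (D.rot i) = true := by
  simp [isRot]

theorem isRot_ref (i : ZMod m) : D.isRot (D.ref i) = false := by
  simp only [isRot, decide_eq_false_iff_not]
  exact fun ⟨j, hj⟩ => D.rot_ne_ref j i hj.symm

/-- Pairing by a class function depending on the coset and the exponent. -/
theorem exists_pairing_of_class {κ : Type*} (f : Bool → ZMod m → κ) (S : Multiset G) :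
    ∃ (V : Multiset (Multiset G)) (L : Multiset G), V.sum + L = S ∧
      (∀ b ∈ V, (∃ i j, b = {D.rot i} + {D.rot j} ∧ f true i = f true j) ∨
        (∃ i j, b = {D.ref i} + {D.ref j} ∧ f false i = f false j)) ∧
      (L.map fun g => (D.isRot g, f (D.isRot g) (D.idx g))).Nodup := by
  obtain ⟨V, L, hVL, hV, hL⟩ :=
    Multiset.exists_pairing (fun g => (D.isRot g, f (D.isRot g) (D.idx g))) S
  refine ⟨V, L, hVL, fun b hb => ?_, hL⟩
  obtain ⟨g, h, rfl, hgh⟩ := hV b hb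
  simp only [Prod.mk.injEq] at hgh
  rcases D.eq_rot_or_eq_ref g with ⟨i, rfl⟩ | ⟨i, rfl⟩ <;>
    rcases D.eq_rot_or_eq_ref h with ⟨j, rfl⟩ | ⟨j, rfl⟩ <;>
    simp only [isRot_rot, isRot_ref, idx_rot, idx_ref, reduceCtorEq, false_and, true_and] at hgh
  · exact Or.inl ⟨i, j, rfl, hgh⟩
  · exact Or.inr ⟨i, j, rfl, hgh⟩

end Index

variable {G : Type*} [Group G] {h : ℕ} {c : ZMod (2 * h)} (D : DihedralRep G (2 * h) c)

/-- A pair of elements of the same coset with exponents of the same parity. -/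
def EqualParity (b : Multiset G) : Prop :=
  ∃ i j, ZMod.parity h i = ZMod.parity h j ∧
    (b = {D.rot i} + {D.rot j} ∨ b = {D.ref i} + {D.ref j})

variable {D}

theorem EqualParity.card {b : Multiset G} (hb : D.EqualParity b) : b.card = 2 := by
  obtain ⟨i, j, -, rfl | rfl⟩ := hb <;> simp

theorem EqualParity.exists_orderedProd (hc : ZMod.parity h c = 0) {b : Multiset G}
    (hb : D.EqualParity b) : ∃ i, ZMod.parity h i = 0 ∧ OrderedProd b (D.rot i) := by
  obtain ⟨i, j, hij, rfl | rfl⟩ := hb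
  · refine ⟨_, ?_, D.orderedProd_rot_pair i j⟩
    rw [map_add, hij]
    generalize ZMod.parity h j = x
    revert x
    decide
  · refine ⟨_, ?_, D.orderedProd_ref_pair i j⟩
    rw [map_sub, map_add, hij, hc]
    abel

/-- The products of the pairs are even rotations because `c` is even. These form a group of order
`h`, so `2 * h - 1` pairs suffice for Erdős–Ginzburg–Ziv. -/
theorem hasProductOne_of_equalParity (hh : h ≠ 0) (hc : ZMod.parity h c = 0) {S : Multiset G}
    {V : Multiset (Multiset G)} (hV : ∀ b ∈ V, D.EqualParity b) (hVS : V.sum ≤ S)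
    (hVc : 2 * h ≤ V.card + 1) : HasProductOne S (2 * h) := by
  have : NeZero (2 * h) := ⟨by omega⟩
  choose! v hv0 hv using fun b hb => (hV b hb).exists_orderedProd hc
  obtain ⟨t, ht, htc, ht0⟩ := ZMod.exists_le_card_eq_sum_eq_zero_of_mem v
    (ZMod.parity h).toAddMonoidHom.ker (M := h) (by rw [ZMod.card_ker_parity hh]) V
    (fun b hb => hv0 b hb) (by rw [ZMod.card_ker_parity hh]; omega)
  exact hasProductOne_of_sum_eq_zero (fun b hb => hv b (Multiset.mem_of_le ht hb))
    ((Multiset.sum_le_sum_of_le ht).trans hVS) ht0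
    (fun b hb => (hV b (Multiset.mem_of_le ht hb)).card) (by omega)

variable (D) in
-- There are four classes, given by coset and parity. If four terms are left over, each class occurs
-- once.
theorem exists_equalParity_pairing (S : Multiset G) :
    ∃ (V : Multiset (Multiset G)) (L : Multiset G), V.sum + L = S ∧
      (∀ b ∈ V, D.EqualParity b) ∧ (L.card ≤ 3 ∨ ∃ x₁ x₂ y₁ y₂,
        L = {D.rot x₁} + {D.rot x₂} + ({D.ref y₁} + {D.ref y₂}) ∧ ZMod.parity h x₁ = 0 ∧
        ZMod.parity h x₂ = 1 ∧ ZMod.parity h y₁ = 0 ∧ ZMod.parity h y₂ = 1) := by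
  classical
  obtain ⟨V, L, hVL, hV, hL⟩ := D.exists_pairing_of_class (fun _ i => ZMod.parity h i) S
  refine ⟨V, L, hVL, fun b hb => ?_, ?_⟩
  · rcases hV b hb with ⟨i, j, rfl, hij⟩ | ⟨i, j, rfl, hij⟩
    · exact ⟨i, j, hij, Or.inl rfl⟩
    · exact ⟨i, j, hij, Or.inr rfl⟩
  · by_cases hL3 : L.card ≤ 3
    · exact Or.inl hL3
    right
    have h4 : (⟨_, hL⟩ : Finset (Bool × ZMod 2)) = Finset.univ := by
      rw [← Finset.card_eq_iff_eq_univ]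
      refine le_antisymm (Finset.card_le_univ _) ?_
      rw [Finset.card_mk, Multiset.card_map]
      have : Fintype.card (Bool × ZMod 2) = 4 := by decide
      omega
    have h5 : L.map (fun g => (D.isRot g, ZMod.parity h (D.idx g))) =
        (true, 0) ::ₘ (true, 1) ::ₘ (false, 0) ::ₘ (false, 1) ::ₘ 0 := by
      have := congrArg Finset.val h4
      rw [show (Finset.univ : Finset (Bool × ZMod 2)).val =
        (true, 0) ::ₘ (true, 1) ::ₘ (false, 0) ::ₘ (false, 1) ::ₘ 0 by decide] at this
      exact this
    have hrot : ∀ g (a : ZMod 2), (D.isRot g, ZMod.parity h (D.idx g)) = (true, a) →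
        ∃ x, g = D.rot x ∧ ZMod.parity h x = a := by
      intro g a hg
      rcases D.eq_rot_or_eq_ref g with ⟨i, rfl⟩ | ⟨i, rfl⟩
      · simp only [isRot_rot, idx_rot, Prod.mk.injEq, true_and] at hg
        exact ⟨i, rfl, hg⟩
      · simp [isRot_ref] at hg
    have href : ∀ g (a : ZMod 2), (D.isRot g, ZMod.parity h (D.idx g)) = (false, a) →
        ∃ x, g = D.ref x ∧ ZMod.parity h x = a := by
      intro g a hg
      rcases D.eq_rot_or_eq_ref g with ⟨i, rfl⟩ | ⟨i, rfl⟩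
      · simp [isRot_rot] at hg
      · simp only [isRot_ref, idx_ref, Prod.mk.injEq, true_and] at hg
        exact ⟨i, rfl, hg⟩
    obtain ⟨g₁, m₁, e₁, h5⟩ := (Multiset.map_eq_cons _ _ _ _).2 h5
    obtain ⟨g₂, m₂, e₂, h5⟩ := (Multiset.map_eq_cons _ _ _ _).2 h5
    obtain ⟨g₃, m₃, e₃, h5⟩ := (Multiset.map_eq_cons _ _ _ _).2 h5
    obtain ⟨g₄, m₄, e₄, h5⟩ := (Multiset.map_eq_cons _ _ _ _).2 h5
    rw [Multiset.map_eq_zero] at h5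
    have hL4 : L = {g₁} + {g₂} + ({g₃} + {g₄}) := by
      rw [← Multiset.cons_erase m₁, ← Multiset.cons_erase m₂, ← Multiset.cons_erase m₃,
        ← Multiset.cons_erase m₄, h5, ← Multiset.singleton_add, ← Multiset.singleton_add g₂,
        ← Multiset.singleton_add g₃, Multiset.cons_zero]
      abel
    obtain ⟨x₁, rfl, p₁⟩ := hrot _ _ e₁
    obtain ⟨x₂, rfl, p₂⟩ := hrot _ _ e₂
    obtain ⟨y₁, rfl, p₃⟩ := href _ _ e₃
    obtain ⟨y₂, rfl, p₄⟩ := href _ _ e₄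
    exact ⟨x₁, x₂, y₁, y₂, hL4, p₁, p₂, p₃, p₄⟩

end DihedralRep

/-! ### Dihedral and dicyclic groups: the even case -/

namespace DihedralRep

variable {G : Type*} [Group G]

/-- If fewer than four terms are left over, there are three pairs. Otherwise the two leftover
reflections contribute an odd `w`; `x₁ + x₂ + w` and `x₁ - x₂ + w` are even and differ by 2 mod 4,
so one of them vanishes. -/
theorem hasProductOne_of_four {c : ZMod (2 * 2)} (D : DihedralRep G (2 * 2) c)
    (hc : ZMod.parity 2 c = 0) (S : Multiset G) (hS : 8 ≤ S.card) : HasProductOne S 4 := by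
  obtain ⟨S₀, hS₀, hS₀c⟩ := Multiset.exists_le_card_eq' S hS
  refine HasProductOne.mono ?_ hS₀
  obtain ⟨V, L, hVL, hV, hL⟩ := D.exists_equalParity_pairing S₀
  rcases hL with hL | ⟨x₁, x₂, y₁, y₂, hL, p₁, p₂, p₃, p₄⟩
  · refine hasProductOne_of_equalParity (h := 2) (by norm_num) hc hV
      (hVL ▸ Multiset.le_add_right _ _) ?_
    have := congrArg Multiset.card hVL
    rw [Multiset.card_add, Multiset.card_sum_of_forall fun b hb => (hV b hb).card] at this
    omega
  · have hle : {D.rot x₁} + {D.rot x₂} + ({D.ref y₁} + {D.ref y₂}) ≤ S₀ := by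
      rw [← hVL, hL]
      exact Multiset.le_add_left _ _
    have h1 := (Twisted.rot (D := D) x₁).add (Twisted.rot x₂)
    have h2 := (Twisted.rot (D := D) x₁).add (Twisted.rot x₂).neg
    have key : x₁ + x₂ + (c + y₂ - y₁) = 0 ∨ x₁ + -x₂ + (c + y₂ - y₁) = 0 := by
      have hw : ZMod.parity 2 (c + y₂ - y₁) = 1 := by
        rw [map_sub, map_add, hc, p₃, p₄]
        decide
      generalize c + y₂ - y₁ = w at hw
      clear hle h1 h2 hL hVL p₃ p₄ hc
      revert x₁ x₂ w
      decide
    rcases key with key | key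
    · exact hasProductOne_of_twisted h1 hle key (by simp)
    · exact hasProductOne_of_twisted h2 hle key (by simp)

variable {p : ℕ} [hp : Fact p.Prime] {D : DihedralRep G (2 * p) 0}

theorem hasProductOne_of_reduce_eq_zero (hp2 : Odd p) {S : Multiset G}
    {V : Multiset (Multiset G)} {v : Multiset G → ZMod (2 * p)} (hVS : V.sum ≤ S)
    (hV : ∀ b ∈ V, b.card = 2 ∧ ZMod.parity p (v b) = 0 ∧ OrderedProd b (D.rot (v b)))
    (h0 : ∀ b ∈ V, ZMod.reduce p (v b) = 0) (hc : p ≤ V.card) : HasProductOne S (2 * p) := by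
  obtain ⟨t, ht, htc⟩ := Multiset.exists_le_card_eq' V hc
  have hmem : ∀ b ∈ t, b ∈ V := fun b hb => Multiset.mem_of_le ht hb
  refine hasProductOne_of_sum_eq_zero (fun b hb => (hV b (hmem b hb)).2.2)
    ((Multiset.sum_le_sum_of_le ht).trans hVS) ?_ (fun b hb => (hV b (hmem b hb)).1)
    (by rw [htc]; ring)
  refine Multiset.sum_eq_zero fun x hx => ?_
  obtain ⟨b, hb, rfl⟩ := Multiset.mem_map.1 hx
  exact ZMod.eq_zero_of_parity_of_reduce hp2 (hV b (hmem b hb)).2.1 (h0 b (hmem b hb))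

theorem _root_.ZMod.addSubgroup_eq_bot_or_eq_top (K : AddSubgroup (ZMod p)) : K = ⊥ ∨ K = ⊤ := by
  have h := K.card_mul_index
  rw [Nat.card_zmod] at h
  rcases (Nat.dvd_prime hp.out).1 ⟨_, h.symm⟩ with h1 | h1
  · exact Or.inl (AddSubgroup.eq_bot_of_card_eq K h1)
  · right
    rw [h1] at h
    exact AddSubgroup.index_eq_one.1 (Nat.eq_of_mul_eq_mul_left hp.out.pos 
      (h.trans (mul_one p).symm))

/-- At least `p - 1` pairs have product nonzero mod `p`, or `p` of the others would do. Signed sums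
of `p - 2` of them take every nonzero value mod `p`; with the four leftover terms the length is `2 *
p`. So the contribution of the leftover terms must vanish mod `p` for each choice of signs. -/
theorem reduce_eq_zero_of_not_hasProductOne (hp2 : Odd p) {S : Multiset G}
    (hno : ¬ HasProductOne S (2 * p)) {V : Multiset (Multiset G)} {x₁ x₂ y₁ y₂ : ZMod (2 * p)}
    (hV : ∀ b ∈ V, D.EqualParity b) (hVc : V.card + 2 = 2 * p)
    (hS : V.sum + ({D.rot x₁} + {D.rot x₂} + ({D.ref y₁} + {D.ref y₂})) = S)
    (p₁ : ZMod.parity p x₁ = 0) (p₂ : ZMod.parity p x₂ = 1) (p₃ : ZMod.parity p y₁ = 0)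
    (p₄ : ZMod.parity p y₂ = 1) :
    ZMod.reduce p x₁ = 0 ∧ ZMod.reduce p x₂ = 0 ∧ ZMod.reduce p y₁ = ZMod.reduce p y₂ := by
  have hp3 : 2 ≤ p := hp.out.two_le
  choose! v hv0 hv using fun b hb => (hV b hb).exists_orderedProd (map_zero _)
  have hout : p ≤ outside (fun b => ZMod.reduce p (v b)) ⊥ V + 1 := by
    by_contra hlt
    obtain ⟨W, hW, hW0, hWc⟩ := exists_inside (fun b => ZMod.reduce p (v b)) ⊥ V
    have hmem : ∀ b ∈ W, b ∈ V := fun b hb => Multiset.mem_of_le hW hb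
    refine hno (hasProductOne_of_reduce_eq_zero (D := D) (v := v) hp2 (V := W) ?_
      (fun b hb => ⟨(hV b (hmem b hb)).card, hv0 b (hmem b hb), hv b (hmem b hb)⟩)
      (fun b hb => by simpa using hW0 b hb) (by omega))
    rw [← hS]
    exact (Multiset.sum_le_sum_of_le hW).trans (Multiset.le_add_right _ _)
  obtain ⟨W, hW, hW0, hWc⟩ := exists_outside (fun b => ZMod.reduce p (v b)) ⊥ V
  obtain ⟨U, hU, hUc⟩ := Multiset.exists_le_card_eq' W (k := p - 2) (by omega)
  obtain ⟨U', hU', hU'c, hd⟩ := ZMod.exists_le_forall_signed_sum hp2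
    (fun b => ZMod.reduce p (v b)) U (M := p - 2) (Or.inr hUc.symm) (by omega)
    (fun K h1 h2 => ((ZMod.addSubgroup_eq_bot_or_eq_top K).elim h1 h2).elim)
    (by
      rw [outside_eq_card fun b hb => hW0 b (Multiset.mem_of_le hU hb), hUc]
      omega)
  have key : ∀ u, D.Twisted ({D.rot x₁} + {D.rot x₂}) u → ZMod.parity p u = 1 →
      ZMod.reduce p u + ZMod.reduce p y₂ - ZMod.reduce p y₁ = 0 := by
    intro u hu hu1
    by_contra hne
    obtain ⟨P, Q, hPQ, hPQd⟩ := hd (-(ZMod.reduce p u + ZMod.reduce p y₂ - ZMod.reduce p y₁))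
      (Or.inl (neg_ne_zero.2 hne))
    have hle : P + Q ≤ V := hPQ.trans_le (hU'.trans (hU.trans hW))
    have hmem : ∀ b ∈ P + Q, b ∈ V := fun b hb => Multiset.mem_of_le hle hb
    refine hno (hasProductOne_of_twisted ((D.twisted_sum_sub (v := v) fun b hb =>
      .of_orderedProd (hv b (hmem b hb))).add hu) (y := y₁) (z := y₂) ?_ ?_ ?_)
    · rw [← hS, add_assoc (P + Q).sum]
      gcongr
      exact Multiset.sum_le_sum_of_le hle
    · have hz : ∀ X : Multiset (Multiset G), (∀ b ∈ X, b ∈ V) →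
          ZMod.parity p (X.map v).sum = 0 := by
        intro X hX
        rw [map_multiset_sum, Multiset.map_map]
        refine Multiset.sum_eq_zero fun x hx => ?_
        obtain ⟨b, hb, rfl⟩ := Multiset.mem_map.1 hx
        exact hv0 b (hX b hb)
      refine ZMod.eq_zero_of_parity_of_reduce hp2 ?_ ?_
      · simp only [map_add, map_sub, map_zero, hu1, p₃, p₄,
          hz P fun b hb => hmem b (by simp [hb]), hz Q fun b hb => hmem b (by simp [hb])]
        decide
      · rw [map_add, map_add, map_sub, map_multiset_sum, map_multiset_sum, Multiset.map_map,
          Multiset.map_map]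
        simp only [Function.comp_def, map_sub, map_add, map_zero]
        rw [hPQd]
        abel
    · rw [Multiset.card_add, Multiset.card_sum_of_forall fun b hb => (hV b (hmem b hb)).card, hPQ,
        hU'c]
      simp
      omega
  -- The sign choices `(+,+)`, `(+,-)`, `(-,+)` determine both rotations, since 2 is invertible mod
  -- `p`.
  have k1 := key _ ((Twisted.rot (D := D) x₁).add (Twisted.rot x₂)) (by
    rw [map_add, p₁, p₂]; decide)
  have k2 := key _ ((Twisted.rot (D := D) x₁).add (Twisted.rot x₂).neg) (by
    rw [map_add, map_neg, p₁, p₂]; decide)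
  have k3 := key _ ((Twisted.rot (D := D) x₁).neg.add (Twisted.rot x₂)) (by
    rw [map_add, map_neg, p₁, p₂]; decide)
  rw [map_add] at k1 k2 k3
  rw [map_neg] at k2 k3
  have h0 : ∀ x : ZMod p, x + x = 0 → x = 0 := fun x hx => by
    simpa using ZMod.mem_of_add_self_mem hp2 ⊥ (x := x) (by simpa using hx)
  have e1 : ZMod.reduce p x₁ = 0 := h0 _ (by linear_combination k1 - k3)
  have e2 : ZMod.reduce p x₂ = 0 := h0 _ (by linear_combination k1 - k2)
  refine ⟨e1, e2, ?_⟩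
  rw [e1, e2] at k1
  linear_combination -k1

/-- In the absence of a solution, any term of a pair can be exchanged with the leftover term of its
class. Hence all paired rotations vanish mod `p` and all paired reflections agree mod `p`; every
pair then has product one, and `p` pairs contradict the assumption. -/
theorem hasProductOne_of_two_mul_prime (hp2 : Odd p) (D : DihedralRep G (2 * p) 0)
    (S : Multiset G) (hS : 2 * (2 * p) ≤ S.card) : HasProductOne S (2 * p) := by
  have hp3 : 2 ≤ p := hp.out.two_le
  obtain ⟨S₀, hS₀, hS₀c⟩ := Multiset.exists_le_card_eq' S hS
  refine HasProductOne.mono ?_ hS₀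
  obtain ⟨V, L, hVL, hV, hL⟩ := D.exists_equalParity_pairing S₀
  have hcard := congrArg Multiset.card hVL
  rw [Multiset.card_add, Multiset.card_sum_of_forall fun b hb => (hV b hb).card] at hcard
  rcases hL with hL | ⟨x₁, x₂, y₁, y₂, rfl, p₁, p₂, p₃, p₄⟩
  · exact hasProductOne_of_equalParity (by omega) (map_zero _) hV
      (hVL ▸ Multiset.le_add_right _ _) (by omega)
  by_contra hno
  simp only [Multiset.card_add, Multiset.card_singleton] at hcard
  have hy := (reduce_eq_zero_of_not_hasProductOne hp2 hno hV (by omega) hVL p₁ p₂ p₃ p₄).2.2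
  have hz : ∀ b ∈ V, ∃ i, ZMod.parity p i = 0 ∧ ZMod.reduce p i = 0 ∧
      OrderedProd b (D.rot i) := by
    intro b hb
    obtain ⟨i, j, hij, hbij⟩ := hV b hb
    obtain ⟨i', hi', hbi'⟩ := (hV b hb).exists_orderedProd (map_zero _)
    obtain ⟨V', rfl⟩ := Multiset.exists_cons_of_mem hb
    rw [Multiset.sum_cons] at hVL
    rw [Multiset.card_cons] at hcard
    have swap : ∀ b', D.EqualParity b' → ∀ b'' ∈ b' ::ₘ V', D.EqualParity b'' := by
      intro b' hb' b'' hb''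
      rcases Multiset.mem_cons.1 hb'' with rfl | hb''
      · exact hb'
      · exact hV _ (Multiset.mem_cons_of_mem hb'')
    have h01 : ∀ x : ZMod 2, x = 0 ∨ x = 1 := by decide
    rcases hbij with rfl | rfl
    · have hi : ∀ i j, ZMod.parity p i = ZMod.parity p j →
          {D.rot i} + {D.rot j} + V'.sum +
            ({D.rot x₁} + {D.rot x₂} + ({D.ref y₁} + {D.ref y₂})) = S₀ →
          ZMod.reduce p i = 0 := by
        intro i j hij hVL
        rcases h01 (ZMod.parity p i) with hpi | hpi
        · exact (reduce_eq_zero_of_not_hasProductOne (D := D) hp2 hno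
            (V := ({D.rot x₁} + {D.rot j}) ::ₘ V') (x₁ := i) (x₂ := x₂) (y₁ := y₁) (y₂ := y₂)
            (swap _ ⟨x₁, j, by rw [p₁, ← hij, hpi], Or.inl rfl⟩)
            (by rw [Multiset.card_cons]; omega)
            (by rw [← hVL, Multiset.sum_cons]; abel) hpi p₂ p₃ p₄).1
        · exact (reduce_eq_zero_of_not_hasProductOne (D := D) hp2 hno
            (V := ({D.rot x₂} + {D.rot j}) ::ₘ V') (x₁ := x₁) (x₂ := i) (y₁ := y₁) (y₂ := y₂)
            (swap _ ⟨x₂, j, by rw [p₂, ← hij, hpi], Or.inl rfl⟩)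
            (by rw [Multiset.card_cons]; omega)
            (by rw [← hVL, Multiset.sum_cons]; abel) p₁ hpi p₃ p₄).2.1
      refine ⟨i + j, ?_, ?_, D.orderedProd_rot_pair i j⟩
      · rw [map_add, hij]
        generalize ZMod.parity p j = x
        revert x
        decide
      · rw [map_add, hi i j hij hVL, hi j i hij.symm (by rw [← hVL]; abel), add_zero]
    · have hi : ∀ i j, ZMod.parity p i = ZMod.parity p j →
          {D.ref i} + {D.ref j} + V'.sum +
            ({D.rot x₁} + {D.rot x₂} + ({D.ref y₁} + {D.ref y₂})) = S₀ →
          ZMod.reduce p i = ZMod.reduce p y₁ := by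
        intro i j hij hVL
        rcases h01 (ZMod.parity p i) with hpi | hpi
        · exact ((reduce_eq_zero_of_not_hasProductOne (D := D) hp2 hno
            (V := ({D.ref y₁} + {D.ref j}) ::ₘ V') (x₁ := x₁) (x₂ := x₂) (y₁ := i) (y₂ := y₂)
            (swap _ ⟨y₁, j, by rw [p₃, ← hij, hpi], Or.inr rfl⟩)
            (by rw [Multiset.card_cons]; omega)
            (by rw [← hVL, Multiset.sum_cons]; abel) p₁ p₂ hpi p₄).2.2).trans hy.symm
        · exact ((reduce_eq_zero_of_not_hasProductOne (D := D) hp2 hno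
            (V := ({D.ref y₂} + {D.ref j}) ::ₘ V') (x₁ := x₁) (x₂ := x₂) (y₁ := y₁) (y₂ := i)
            (swap _ ⟨y₂, j, by rw [p₄, ← hij, hpi], Or.inr rfl⟩)
            (by rw [Multiset.card_cons]; omega)
            (by rw [← hVL, Multiset.sum_cons]; abel) p₁ p₂ p₃ hpi).2.2).symm
      refine ⟨0 + j - i, ?_, ?_, D.orderedProd_ref_pair i j⟩
      · rw [map_sub, map_add, hij, map_zero]
        abel
      · rw [map_sub, map_add, hi i j hij hVL, hi j i hij.symm (by rw [← hVL]; abel), map_zero]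
        abel
  choose! v hv using hz
  refine hno (hasProductOne_of_reduce_eq_zero (D := D) (v := v) hp2 (V := V) ?_
    (fun b hb => ⟨(hV b hb).card, (hv b hb).1, (hv b hb).2.2⟩) (fun b hb => (hv b hb).2.1)
    (by omega))
  rw [← hVL]
  exact Multiset.le_add_right _ _

end DihedralRep

/-! ### The concrete groups -/

namespace DihedralGroup

/-- The standard description of the dihedral group. -/
def dihedralRep (n : ℕ) : DihedralRep (DihedralGroup n) n 0 where
  rot := r
  ref := sr
  rot_zero := rfl
  rot_mul_rot _ _ := rfl
  rot_mul_ref _ _ := rfl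
  ref_mul_rot _ _ := rfl
  ref_mul_ref i j := by rw [sr_mul_sr, zero_add]
  eq_rot_or_eq_ref g := by
    cases g with
    | r i => exact Or.inl ⟨i, rfl⟩
    | sr i => exact Or.inr ⟨i, rfl⟩
  rot_injective i j h := by simpa using h
  rot_ne_ref i j := by simp

/-- Reduction of exponents. -/
def reduceHom {n q : ℕ} (h : q ∣ n) : DihedralGroup n →* DihedralGroup q where
  toFun
    | r i => r (ZMod.castHom h _ i)
    | sr i => sr (ZMod.castHom h _ i)
  map_one' := by
    change r (ZMod.castHom h _ 0) = 1
    rw [map_zero]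
    rfl
  map_mul' g g' := by
    cases g <;> cases g' <;> simp only [r_mul_r, r_mul_sr, sr_mul_r, sr_mul_sr, map_add, map_sub]

theorem hasProductOne_mul {q k : ℕ} (hq : q ≠ 0) (hk : k ≠ 0)
    (hqS : ∀ S : Multiset (DihedralGroup q), 2 * q ≤ S.card → HasProductOne S q)
    (S : Multiset (DihedralGroup (q * k))) (hS : 2 * (q * k) ≤ S.card) :
    HasProductOne S (q * k) := by
  have : NeZero k := ⟨hk⟩
  have : NeZero (q * k) := ⟨Nat.mul_ne_zero hq hk⟩
  have hlift : (zmultiplesHom (ZMod (q * k)) (q : ZMod (q * k))) (k : ℤ) = 0 := by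
    have : ((k * q : ℕ) : ZMod (q * k)) = 0 := by rw [mul_comm]; exact ZMod.natCast_self _
    simpa using this
  -- Multiplication by `q` parametrizes the kernel of reduction mod `q`.
  let f : ZMod k →+ ZMod (q * k) := ZMod.lift k ⟨zmultiplesHom _ (q : ZMod (q * k)), hlift⟩
  refine hasProductOne_of_quotient (reduceHom (dvd_mul_right q k)) hk (fun i => r (f i))
    (by rw [map_zero]; rfl) (fun i j => by rw [r_mul_r, map_add]) ?_ hqS S hS
  intro g hg
  cases g with
  | sr i =>
    cases (show sr _ = r 0 from hg)
  | r i =>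
    have hi : ZMod.castHom (dvd_mul_right q k) (ZMod q) i = 0 := by
      exact r.inj hg
    rw [← ZMod.natCast_zmod_val i, map_natCast, ZMod.natCast_eq_zero_iff] at hi
    obtain ⟨u, hu⟩ := hi
    refine ⟨(u : ZMod k), ?_⟩
    congr 1
    have : f (((u : ℤ) : ZMod k)) = (u : ℤ) • (q : ZMod (q * k)) := by
      simp only [f, ZMod.lift_coe, zmultiplesHom_apply]
    rw [← Int.cast_natCast, this, ← ZMod.natCast_zmod_val i, hu]
    push_cast
    rw [zsmul_eq_mul]
    push_cast
    ring

theorem hasProductOne_of_even {n : ℕ} (hn : Even n) (hn4 : 4 ≤ n)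
    (S : Multiset (DihedralGroup n)) (hS : 2 * n ≤ S.card) : HasProductOne S n := by
  obtain ⟨h, hn⟩ := hn
  rcases Nat.even_or_odd h with ⟨k, rfl⟩ | hodd
  · obtain rfl : n = 4 * k := by omega
    exact hasProductOne_mul (by norm_num) (by omega)
      (fun S hS => (dihedralRep 4).hasProductOne_of_four (map_zero _) S hS) S hS
  · have hne : h ≠ 1 := by omega
    have : Fact h.minFac.Prime := ⟨Nat.minFac_prime hne⟩
    obtain ⟨k, hk⟩ := Nat.minFac_dvd h
    have hp2 : Odd h.minFac := hodd.of_dvd_nat (Nat.minFac_dvd h)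
    have hk0 : k ≠ 0 := by rintro rfl; omega
    generalize h.minFac = p at *
    obtain rfl : n = 2 * p * k := by rw [mul_assoc, ← hk]; omega
    exact hasProductOne_mul (Nat.mul_ne_zero (by norm_num) this.out.ne_zero) hk0
      (fun S hS => DihedralRep.hasProductOne_of_two_mul_prime hp2 (dihedralRep _) S hS) S hS

end DihedralGroup

namespace QuaternionGroup

/-- The standard description of the dicyclic group. -/
def dihedralRep (n : ℕ) : DihedralRep (QuaternionGroup n) (2 * n) n where
  rot := a
  ref := xa
  rot_zero := rfl
  rot_mul_rot _ _ := rfl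
  rot_mul_ref _ _ := rfl
  ref_mul_rot _ _ := rfl
  ref_mul_ref _ _ := rfl
  eq_rot_or_eq_ref g := by
    cases g with
    | a i => exact Or.inl ⟨i, rfl⟩
    | xa i => exact Or.inr ⟨i, rfl⟩
  rot_injective i j h := by simpa using h
  rot_ne_ref i j := by simp

/-- The quotient of the dicyclic group by its central involution. -/
def toDihedral (n : ℕ) : QuaternionGroup n →* DihedralGroup n where
  toFun
    | a i => DihedralGroup.r (ZMod.reduce n i)
    | xa i => DihedralGroup.sr (ZMod.reduce n i)
  map_one' := by
    change DihedralGroup.r (ZMod.reduce n 0) = 1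
    rw [map_zero]
    rfl
  map_mul' g g' := by
    cases g <;> cases g' <;> simp only [a_mul_a, a_mul_xa, xa_mul_a, xa_mul_xa, map_add, map_sub,
      map_natCast, CharP.cast_eq_zero, zero_add, DihedralGroup.r_mul_r, DihedralGroup.r_mul_sr,
      DihedralGroup.sr_mul_r, DihedralGroup.sr_mul_sr]

theorem hasProductOne_of_even {n : ℕ} (hn : Even n) (hn2 : 2 ≤ n)
    (S : Multiset (QuaternionGroup n)) (hS : 4 * n ≤ S.card) : HasProductOne S (2 * n) := by
  rcases hn2.eq_or_lt with rfl | hn2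
  · exact (dihedralRep 2).hasProductOne_of_four (by simp; decide) S hS
  have hn4 : 4 ≤ n := by
    obtain ⟨k, rfl⟩ := hn
    omega
  have : NeZero (2 * n) := ⟨by omega⟩
  have hnn : ((n : ℕ) : ZMod (2 * n)) + n = 0 := by
    have : ((2 * n : ℕ) : ZMod (2 * n)) = 0 := ZMod.natCast_self _
    push_cast at this
    linear_combination this
  rw [mul_comm 2 n]
  refine hasProductOne_of_quotient (toDihedral n) two_ne_zero
    (fun i : ZMod 2 => if i = 0 then a 0 else a n) rfl ?_ ?_
    (fun S hS => DihedralGroup.hasProductOne_of_even hn hn4 S hS) S (by omega)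
  · intro i j
    have : ∀ i j : ZMod 2, (i = 0 ∧ j = 0 ∧ i + j = 0) ∨ (i = 0 ∧ j ≠ 0 ∧ i + j ≠ 0) ∨
      (i ≠ 0 ∧ j = 0 ∧ i + j ≠ 0) ∨ (i ≠ 0 ∧ j ≠ 0 ∧ i + j = 0) := by decide
    rcases this i j with ⟨h1, h2, h3⟩ | ⟨h1, h2, h3⟩ | ⟨h1, h2, h3⟩ | ⟨h1, h2, h3⟩ <;>
      simp only [h1, h2, h3, if_true, if_false, a_mul_a, add_zero, zero_add, hnn]
  · intro g hg
    cases g with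
    | xa i =>
      cases (show DihedralGroup.sr _ = DihedralGroup.r 0 from hg)
    | a i =>
      have hi : ZMod.reduce n i = 0 := by
        exact DihedralGroup.r.inj hg
      have hlt := ZMod.val_lt i
      rw [← ZMod.natCast_zmod_val i, map_natCast, ZMod.natCast_eq_zero_iff] at hi
      obtain ⟨u, hu⟩ := hi
      have hu2 : u < 2 := by
        by_contra h
        have : n * 2 ≤ n * u := Nat.mul_le_mul_left n (by omega)
        omega
      interval_cases u
      · refine ⟨0, ?_⟩
        rw [← ZMod.natCast_zmod_val i, hu]
        simp
      · refine ⟨1, ?_⟩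
        rw [← ZMod.natCast_zmod_val i, hu]
        simp

end QuaternionGroup

/-! ### Signed sums of residues modulo twice an odd number -/

theorem Multiset.exists_eq_cons_of_card_pos {β : Type*} {s : Multiset β} (h : 0 < s.card) :
    ∃ b t, s = b ::ₘ t := by
  obtain ⟨b, hb⟩ := Multiset.card_pos_iff_exists_mem.1 h
  exact ⟨b, Multiset.exists_cons_of_mem hb⟩

namespace ZMod

theorem card_comap_reduce {n : ℕ} (hn : n ≠ 0) (K : AddSubgroup (ZMod n)) :
    Nat.card (K.comap (reduce n).toAddMonoidHom) = 2 * Nat.card K := by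
  have : NeZero n := ⟨hn⟩
  have : NeZero (2 * n) := ⟨by omega⟩
  have h1 := (K.comap (reduce n).toAddMonoidHom).card_mul_index
  have h2 := K.card_mul_index
  rw [AddSubgroup.index_comap_of_surjective _ (ZMod.ringHom_surjective (reduce n)),
    Nat.card_zmod] at h1
  rw [Nat.card_zmod] at h2
  refine Nat.eq_of_mul_eq_mul_right (Nat.pos_of_ne_zero K.index_ne_zero_of_finite) ?_
  rw [h1, mul_assoc, h2]

theorem neg_eq_self_two (x : ZMod 2) : -x = x := by
  revert x
  decide

theorem sum_eq_card_nsmul_of_parity {h : ℕ} {W : Multiset (ZMod (2 * h))} {a : ZMod 2}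
    (hW : ∀ b ∈ W, parity h b = a) : parity h W.sum = W.card • a := by
  rw [map_multiset_sum, Multiset.map_congr rfl hW, Multiset.map_const', Multiset.sum_replicate]

/-- Signs are irrelevant mod 2: the parity depends only on which terms are used. -/
theorem parity_sub_sum {h : ℕ} (p q : Multiset (ZMod (2 * h))) :
    parity h (p.sum - q.sum) = parity h (p + q).sum := by
  rw [Multiset.sum_add, map_sub, map_add, sub_eq_add_neg, neg_eq_self_two]

section

variable {n : ℕ} {R : Multiset (ZMod (2 * n))}

/-- The preimage of `K` has order `2 * Nat.card K`, which divides `4 * n`; too many terms in it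
would give a forbidden zero sum. -/
theorem card_add_two_le_outside (hn : n ≠ 0) (hno : ¬ ∃ t ≤ R, t.card = 4 * n ∧ t.sum = 0)
    (K : AddSubgroup (ZMod n)) :
    R.card + 2 ≤ outside (reduce n) K R + 4 * n + 2 * Nat.card K := by
  have : NeZero n := ⟨hn⟩
  have : NeZero (2 * n) := ⟨by omega⟩
  by_contra hlt
  obtain ⟨W, hW, hWK, hWc⟩ := exists_inside (reduce n) K R
  obtain ⟨t, ht, htc, ht0⟩ := ZMod.exists_le_card_eq_sum_eq_zero_of_mem id
    (K.comap (reduce n).toAddMonoidHom) (M := 4 * n) (by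
      rw [card_comap_reduce hn]
      have : Nat.card K ∣ n := by simpa using K.card_addSubgroup_dvd_card
      have : 2 * Nat.card K ∣ 2 * n := Nat.mul_dvd_mul_left 2 this
      exact this.trans ⟨2, by ring⟩) W (fun b hb => hWK b hb)
    (by rw [card_comap_reduce hn]; omega)
  exact hno ⟨t, ht.trans hW, htc, by simpa using ht0⟩

/-- Two terms of opposite parity are reserved for correcting parity, at little cost in terms outside
the small subgroups: a term vanishing mod `n` is preferred, then one in the subgroup of order 3. If
all terms vanishing mod `n` have the same parity, they are equal, so there are fewer than `4 * n` of
them. -/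
theorem exists_cons_cons_of_parity_ne (hn : Odd n)
    (hno : ¬ ∃ t ≤ R, t.card = 4 * n ∧ t.sum = 0)
    (hmix : ∃ a ∈ R, ∃ b ∈ R, parity n a ≠ parity n b) :
    ∃ a b V, R = a ::ₘ b ::ₘ V ∧ parity n a ≠ parity n b ∧
      R.card ≤ outside (reduce n) ⊥ V + 4 * n ∧
      ∀ K : AddSubgroup (ZMod n), Nat.card K = 3 →
        outside (reduce n) K R ≤ outside (reduce n) K V + 1 ∨
        outside (reduce n) K V = V.card := by
  have hn0 : n ≠ 0 := by rintro rfl; simp at hn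
  have : NeZero n := ⟨hn0⟩
  have hother : ∀ a : ZMod (2 * n), ∃ b ∈ R, parity n a ≠ parity n b := by
    intro a
    obtain ⟨x, hx, y, hy, hxy⟩ := hmix
    by_cases h : parity n a = parity n x
    · exact ⟨y, hy, by rwa [h]⟩
    · exact ⟨x, hx, h⟩
  have hsplit : ∀ a ∈ R, ∀ b ∈ R, parity n a ≠ parity n b → ∃ V, R = a ::ₘ b ::ₘ V := by
    intro a ha b hb hab
    obtain ⟨V, rfl⟩ := Multiset.exists_cons_of_mem ha
    have hb' : b ∈ V := by
      rcases Multiset.mem_cons.1 hb with rfl | hb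
      · exact absurd rfl hab
      · exact hb
    obtain ⟨V, rfl⟩ := Multiset.exists_cons_of_mem hb'
    exact ⟨V, rfl⟩
  have hbot := card_add_two_le_outside hn0 hno ⊥
  rw [AddSubgroup.card_bot] at hbot
  by_cases hz : ∃ a ∈ R, reduce n a = 0
  · obtain ⟨a, ha, ha0⟩ := hz
    have hmemK : ∀ (K : AddSubgroup (ZMod n)) (b : ZMod (2 * n)), reduce n b = 0 →
        reduce n b ∈ K := fun K b hb => by rw [hb]; exact K.zero_mem
    by_cases hz' : ∃ b ∈ R, reduce n b = 0 ∧ parity n a ≠ parity n b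
    · obtain ⟨b, hb, hb0, hab⟩ := hz'
      obtain ⟨V, rfl⟩ := hsplit a ha b hb hab
      have hV : ∀ K : AddSubgroup (ZMod n),
          outside (reduce n) K (a ::ₘ b ::ₘ V) = outside (reduce n) K V := by
        intro K
        rw [outside_cons_of_mem (hmemK K a ha0), outside_cons_of_mem (hmemK K b hb0)]
      refine ⟨a, b, V, rfl, hab, ?_, fun K _ => Or.inl ?_⟩
      · rw [hV] at hbot
        omega
      · rw [hV]
        omega
    · push Not at hz'
      obtain ⟨b, hb, hab⟩ := hother a
      obtain ⟨V, rfl⟩ := hsplit a ha b hb hab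
      have hV : ∀ K : AddSubgroup (ZMod n),
          outside (reduce n) K (a ::ₘ b ::ₘ V) ≤ outside (reduce n) K V + 1 := by
        intro K
        rw [outside_cons_of_mem (hmemK K a ha0)]
        exact outside_cons_le _ _ _ _
      refine ⟨a, b, V, rfl, hab, ?_, fun K _ => Or.inl (hV K)⟩
      have hV0 := hV ⊥
      by_contra hlt
      obtain ⟨W, hW, hWK, hWc⟩ := exists_inside (reduce n) ⊥ (a ::ₘ b ::ₘ V)
      obtain ⟨t, ht, htc⟩ := Multiset.exists_le_card_eq' W (k := 4 * n) (by omega)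
      refine hno ⟨t, ht.trans hW, htc, ?_⟩
      have hta : ∀ x ∈ t, x = a := by
        intro x hx
        have hxW := Multiset.mem_of_le ht hx
        have hx0 : reduce n x = 0 := by simpa using hWK x hxW
        have := hz' x (Multiset.mem_of_le hW hxW) hx0
        refine sub_eq_zero.1 (eq_zero_of_parity_of_reduce hn ?_ ?_)
        · rw [map_sub, this, sub_self]
        · rw [map_sub, hx0, ha0, sub_self]
      rw [Multiset.eq_replicate_of_mem hta, Multiset.sum_replicate, htc]
      have h2 : ((2 * n : ℕ) : ZMod (2 * n)) = 0 := ZMod.natCast_self _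
      rw [nsmul_eq_mul, show 4 * n = 2 * n * 2 by ring, Nat.cast_mul, h2, zero_mul, zero_mul]
  · push Not at hz
    have hbotV : ∀ a b V, R = a ::ₘ b ::ₘ V → R.card ≤ outside (reduce n) ⊥ V + 4 * n := by
      rintro a b V rfl
      rw [outside_eq_card fun x hx => by simpa using hz x (by simp [hx])]
      simp only [Multiset.card_cons]
      omega
    by_cases h3 : ∃ a ∈ R, 3 • reduce n a = 0
    · obtain ⟨a, ha, ha0⟩ := h3
      obtain ⟨b, hb, hab⟩ := hother a
      obtain ⟨V, rfl⟩ := hsplit a ha b hb hab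
      refine ⟨a, b, V, rfl, hab, hbotV _ _ _ rfl, fun K hK => Or.inl ?_⟩
      rw [outside_cons_of_mem ((ZMod.mem_iff_three_nsmul_eq_zero hK _).2 ha0)]
      exact outside_cons_le _ _ _ _
    · push Not at h3
      obtain ⟨a, ha, b, hb, hab⟩ := hmix
      obtain ⟨V, rfl⟩ := hsplit a ha b hb hab
      refine ⟨a, b, V, rfl, hab, hbotV _ _ _ rfl, fun K hK => Or.inr ?_⟩
      refine outside_eq_card fun x hx hxK => ?_
      exact h3 x (by simp [hx]) ((ZMod.mem_iff_three_nsmul_eq_zero hK _).1 hxK)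

theorem index_and_card_odd (hn : Odd n) {K : AddSubgroup (ZMod n)} (h1 : K ≠ ⊥) (h2 : K ≠ ⊤) :
    K.index * Nat.card K = n ∧ 3 ≤ K.index ∧ (Nat.card K = 3 ∨ 5 ≤ Nat.card K) := by
  have : NeZero n := ⟨by rintro rfl; simp at hn⟩
  have hi : K.index * Nat.card K = n := by
    rw [mul_comm, K.card_mul_index, Nat.card_zmod]
  have hk : Nat.card K ≠ 1 := fun h => h1 (AddSubgroup.eq_bot_of_card_eq K h)
  have hj : K.index ≠ 1 := fun h => h2 (AddSubgroup.index_eq_one.1 h)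
  obtain ⟨⟨u, hu⟩, ⟨w, hw⟩⟩ := Nat.odd_mul.1 (hi.symm ▸ hn)
  refine ⟨hi, by omega, by omega⟩

/-- The signed sums of given length represent all residues, or all residues not divisible by `n`,
when both parities occur. -/
theorem exists_signed_sum_of_parity_ne (hn : Odd n) (hn1 : n ≠ 1) (hR : 5 * n ≤ R.card + 2)
    (hno : ¬ ∃ t ≤ R, t.card = 4 * n ∧ t.sum = 0)
    (hmix : ∃ a ∈ R, ∃ b ∈ R, parity n a ≠ parity n b) (g : ZMod (2 * n))
    (hg : reduce n g ≠ 0 ∨ 5 * n ≤ R.card + 1) :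
    ∃ p q : Multiset (ZMod (2 * n)), p + q ≤ R ∧ (p + q).card + 2 = 4 * n ∧
      p.sum - q.sum = g := by
  have hn0 : n ≠ 0 := by rintro rfl; simp at hn
  have : NeZero n := ⟨hn0⟩
  obtain ⟨a, b, V, hRV, hab, hV0, hV3⟩ := exists_cons_cons_of_parity_ne hn hno hmix
  have hRc : R.card = V.card + 2 := by rw [hRV]; simp
  have hRout : ∀ K, outside (reduce n) K R ≤ outside (reduce n) K V + 2 := by
    intro K
    rw [hRV]
    have := outside_cons_le (reduce n) K a (b ::ₘ V)
    have := outside_cons_le (reduce n) K b V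
    omega
  obtain ⟨W, hW, hWc, hd⟩ := ZMod.exists_le_forall_signed_sum hn (reduce n) V (M := 4 * n - 3)
    (Or.inl (by omega)) (by omega) (by
      intro K h1 h2
      obtain ⟨hi, hj, hk⟩ := index_and_card_odd hn h1 h2
      have hc := card_add_two_le_outside hn0 hno K
      have ho := hRout K
      -- Removing two terms from outside `K` would break the count for index 3 and order 3, hence
      -- the special clause for order 3.
      rcases hk with hk | hk
      · rw [hk] at hi hc
        rcases hV3 K hk with h | h <;> omega
      · obtain ⟨j, hj'⟩ : ∃ j, K.index = j + 2 := ⟨K.index - 2, by omega⟩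
        obtain ⟨k, hk'⟩ : ∃ k, Nat.card K = k + 1 := ⟨Nat.card K - 1, by omega⟩
        rw [hj', hk'] at hi
        have : (j + 2) * (k + 1) = j * k + j + 2 * k + 2 := by ring
        have : 1 * 4 ≤ j * k := Nat.mul_le_mul (by omega) (by omega)
        omega) (by omega)
  -- One of the reserved terms gives the right parity.
  obtain ⟨x, hx, hxp⟩ : ∃ x, x ::ₘ W ≤ R ∧ parity n g = parity n W.sum + parity n x := by
    have : ∀ u v w z : ZMod 2, u ≠ v → z = w + u ∨ z = w + v := by decide
    rcases this _ _ (parity n W.sum) (parity n g) hab with h | h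
    · refine ⟨a, ?_, h⟩
      rw [hRV]
      exact Multiset.cons_le_cons _ (hW.trans (Multiset.le_cons_self _ _))
    · refine ⟨b, ?_, h⟩
      rw [hRV, Multiset.cons_swap]
      exact Multiset.cons_le_cons _ (hW.trans (Multiset.le_cons_self _ _))
  have hcard : (x ::ₘ W).card + 2 = 4 * n := by
    rw [Multiset.card_cons, hWc]
    omega
  by_cases hgx : reduce n g - reduce n x ≠ 0 ∨ n ≤ outside (reduce n) ⊥ V + 1
  · obtain ⟨p, q, rfl, hpq⟩ := hd _ hgx
    refine ⟨x ::ₘ p, q, by rwa [Multiset.cons_add], by rwa [Multiset.cons_add], ?_⟩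
    refine sub_eq_zero.1 (eq_zero_of_parity_of_reduce hn ?_ ?_)
    · rw [Multiset.sum_cons, add_sub_assoc, map_sub, map_add, parity_sub_sum, hxp]
      abel
    · rw [Multiset.sum_cons, add_sub_assoc, map_sub, map_add, map_sub, map_multiset_sum,
        map_multiset_sum, hpq]
      abel
  -- Only zero may be unrepresentable. If both signs of `x` led to zero, `2 * g` and hence `g` would
  -- vanish mod `n`.
  · have hgx' : reduce n g + reduce n x ≠ 0 := by
      push Not at hgx
      intro h
      have hg0 : reduce n g ≠ 0 := by
        rcases hg with hg | hg
        · exact hg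
        · omega
      refine hg0 ?_
      have h2 : reduce n g + reduce n g = 0 := by linear_combination h + hgx.1
      simpa using ZMod.mem_of_add_self_mem hn ⊥ (x := reduce n g) (by simpa using h2)
    obtain ⟨p, q, rfl, hpq⟩ := hd _ (Or.inl hgx')
    refine ⟨p, x ::ₘ q, by rwa [Multiset.add_cons], by rwa [Multiset.add_cons], ?_⟩
    refine sub_eq_zero.1 (eq_zero_of_parity_of_reduce hn ?_ ?_)
    · rw [Multiset.sum_cons, add_comm x, ← sub_sub, map_sub, map_sub, parity_sub_sum, hxp,
        sub_eq_add_neg _ (parity n x), neg_eq_self_two]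
      abel
    · rw [Multiset.sum_cons, add_comm x, ← sub_sub, map_sub, map_sub, map_sub, map_multiset_sum,
        map_multiset_sum, hpq]
      abel

/-- As `4 * n` terms of one parity have even sum, only the sum mod `n` matters and `K` need not be
doubled. -/
theorem card_add_two_le_outside_of_parity_eq (hn : Odd n)
    (hno : ¬ ∃ t ≤ R, t.card = 4 * n ∧ t.sum = 0) {u : ZMod 2} (hu : ∀ a ∈ R, parity n a = u)
    (K : AddSubgroup (ZMod n)) :
    R.card + 2 ≤ outside (reduce n) K R + 4 * n + Nat.card K := by
  have : NeZero n := ⟨by rintro rfl; simp at hn⟩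
  by_contra hlt
  obtain ⟨W, hW, hWK, hWc⟩ := exists_inside (reduce n) K R
  obtain ⟨t, ht, htc, ht0⟩ := ZMod.exists_le_card_eq_sum_eq_zero_of_mem (reduce n) K (M := 4 * n)
    (by
      have : Nat.card K ∣ n := by simpa using K.card_addSubgroup_dvd_card
      exact this.mul_left 4) W (fun b hb => hWK b hb) (by omega)
  refine hno ⟨t, ht.trans hW, htc, eq_zero_of_parity_of_reduce hn ?_ ?_⟩
  · rw [sum_eq_card_nsmul_of_parity fun b hb => hu b (Multiset.mem_of_le (ht.trans hW) hb), htc,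
      show 4 * n = 2 * n * 2 by ring, mul_nsmul, nsmul_eq_mul 2]
    simp [show (2 : ZMod 2) = 0 from rfl]
  · rw [map_multiset_sum, ht0]

theorem exists_signed_sum_of_parity_eq (hn : Odd n) (hR : 5 * n ≤ R.card + 2)
    (hno : ¬ ∃ t ≤ R, t.card = 4 * n ∧ t.sum = 0) {u : ZMod 2} (hu : ∀ a ∈ R, parity n a = u)
    (g : ZMod (2 * n)) (hg : parity n g = 0) {M : ℕ} (hM : Even M) (hnM : n ≤ M + 1)
    (hMR : M ≤ R.card) :
    ∃ p q : Multiset (ZMod (2 * n)), p + q ≤ R ∧ (p + q).card = M ∧ p.sum - q.sum = g := by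
  have : NeZero n := ⟨by rintro rfl; simp at hn⟩
  have hout := card_add_two_le_outside_of_parity_eq hn hno hu
  have hbot := hout ⊥
  rw [AddSubgroup.card_bot] at hbot
  obtain ⟨W, hW, hWc, hd⟩ := ZMod.exists_le_forall_signed_sum hn (reduce n) R (M := M)
    (Or.inl hnM) hMR (by
      intro K h1 h2
      obtain ⟨hi, hj, hk⟩ := index_and_card_odd hn h1 h2
      have hc := hout K
      obtain ⟨j, hj'⟩ : ∃ j, K.index = j + 1 := ⟨K.index - 1, by omega⟩
      obtain ⟨k, hk'⟩ : ∃ k, Nat.card K = k + 1 := ⟨Nat.card K - 1, by omega⟩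
      rw [hj', hk'] at hi
      have : (j + 1) * (k + 1) = j * k + j + k + 1 := by ring
      omega) (by omega)
  obtain ⟨p, q, rfl, hpq⟩ := hd (reduce n g) (Or.inr (by omega))
  refine ⟨p, q, hW, hWc, sub_eq_zero.1 (eq_zero_of_parity_of_reduce hn ?_ ?_)⟩
  · rw [map_sub, parity_sub_sum, hg,
      sum_eq_card_nsmul_of_parity fun b hb => hu b (Multiset.mem_of_le hW hb), hWc]
    obtain ⟨k, rfl⟩ := hM
    rw [← two_mul, mul_comm, mul_nsmul, nsmul_eq_mul 2]
    simp [show (2 : ZMod 2) = 0 from rfl]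
  · rw [map_sub, map_sub, map_multiset_sum, map_multiset_sum, hpq, sub_self]

end

/-- Otherwise all terms equal the sum plus 1, and an odd number of them adds up to that value
instead. -/
theorem sum_mem_of_odd_card {s : Multiset (ZMod 2)} (hs : Odd s.card) : s.sum ∈ s := by
  by_contra h
  have h1 : ∀ x ∈ s, x = s.sum + 1 := by
    intro x hx
    have h2 : ∀ x y : ZMod 2, x ≠ y → x = y + 1 := by decide
    exact h2 _ _ fun he => h (he ▸ hx)
  have h3 : s.sum = s.card • (s.sum + 1) := by
    conv_lhs => rw [Multiset.eq_replicate_of_mem h1, Multiset.sum_replicate]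
  obtain ⟨k, hk⟩ := hs
  rw [hk] at h3
  generalize s.sum = x at h3
  rw [add_nsmul, mul_comm, mul_nsmul, nsmul_eq_mul 2] at h3
  simp [show (2 : ZMod 2) = 0 from rfl] at h3

end ZMod

/-! ### Dicyclic groups of four times odd order -/

namespace DihedralRep

variable {G : Type*} [Group G] {n : ℕ}

/-- Elements can be grouped into pairs having a signed product whose exponent is divisible by `n`,
leaving over at most `n + n / 2 + 1` elements. -/
theorem exists_pairing_of_reduce [NeZero n] {c : ZMod (2 * n)} (hc : ZMod.reduce n c = 0)
    (D : DihedralRep G (2 * n) c) (S : Multiset G) :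
    ∃ (V : Multiset (Multiset G)) (v : Multiset G → ZMod (2 * n)), V.sum ≤ S ∧
      S.card ≤ 2 * V.card + (n / 2 + 1 + n) ∧
      ∀ b ∈ V, b.card = 2 ∧ ZMod.reduce n (v b) = 0 ∧ D.Twisted b (v b) := by
  -- Rotations are classified mod `n` up to sign, as their sign is free; the other terms are
  -- classified mod `n`.
  let F : G → Fin (n / 2 + 1) ⊕ ZMod n := fun g =>
    if D.isRot g then Sum.inl ⟨(ZMod.reduce n (D.idx g)).valMinAbs.natAbs,
      Nat.lt_succ_of_le (ZMod.natAbs_valMinAbs_le _)⟩ else Sum.inr (ZMod.reduce n (D.idx g))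
  obtain ⟨V, L, hVL, hV, hL⟩ := Multiset.exists_pairing F S
  have hV2 := Multiset.card_sum_pairs (V := V) fun b hb => by
    obtain ⟨g, h, hb, -⟩ := hV b hb
    exact ⟨g, h, hb⟩
  have hv : ∀ b ∈ V, ∃ x, ZMod.reduce n x = 0 ∧ D.Twisted b x := by
    intro b hb
    obtain ⟨g, h, rfl, hgh⟩ := hV b hb
    rcases D.eq_rot_or_eq_ref g with ⟨i, rfl⟩ | ⟨i, rfl⟩ <;>
      rcases D.eq_rot_or_eq_ref h with ⟨j, rfl⟩ | ⟨j, rfl⟩ <;>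
      simp only [F, isRot_rot, isRot_ref, idx_rot, idx_ref, if_true, reduceCtorEq, if_false,
        Sum.inl.injEq, Sum.inr.injEq, Fin.mk.injEq, Bool.false_eq_true] at hgh
    · rcases ZMod.natAbs_valMinAbs_eq_natAbs_valMinAbs.1 hgh with h | h
      · exact ⟨i + -j, by rw [map_add, map_neg, h, add_neg_cancel],
          (Twisted.rot i).add (Twisted.rot j).neg⟩
      · exact ⟨i + j, by rw [map_add, h, neg_add_cancel], (Twisted.rot i).add (Twisted.rot j)⟩
    · exact ⟨_, by rw [map_sub, map_add, hc, hgh, zero_add, sub_self],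
        .of_orderedProd (D.orderedProd_ref_pair i j)⟩
  choose! v hv using hv
  refine ⟨V, v, ?_, ?_, fun b hb => ⟨hV2 b hb, hv b hb⟩⟩
  · rw [← hVL]
    exact Multiset.le_add_right _ _
  · have := Multiset.card_le_of_nodup_map hL
    rw [Fintype.card_sum, Fintype.card_fin, ZMod.card] at this
    rw [← hVL, Multiset.card_add, Multiset.card_sum_of_forall hV2]
    omega

/-- Two pairs of elements outside the rotation subgroup which agree modulo `n` allow adjusting the
parity. -/
theorem hasProductOne_of_two_pairs (hn : Odd n) (hn1 : n ≠ 1) {c : ZMod (2 * n)}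
    (hc : ZMod.reduce n c = 0) (D : DihedralRep G (2 * n) c) {S : Multiset G} {i₁ j₁ i₂ j₂ : ZMod (2 * n)}
    (h₁ : ZMod.reduce n i₁ = ZMod.reduce n j₁) (h₂ : ZMod.reduce n i₂ = ZMod.reduce n j₂)
    (hS : 6 * n ≤ S.card + 4) :
    HasProductOne (S + ({D.ref i₁} + {D.ref j₁}) + ({D.ref i₂} + {D.ref j₂})) (4 * n) := by
  have : NeZero n := ⟨by rintro rfl; simp at hn⟩
  have hn0 : 1 ≤ n := NeZero.one_le
  obtain ⟨W, v, hWS, hWc, hW⟩ := D.exists_pairing_of_reduce hc S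
  obtain ⟨V, hVW, hVc⟩ := Multiset.exists_le_card_eq' W (k := 2 * n - 1) (by
    obtain ⟨k, rfl⟩ := hn
    omega)
  have hV : ∀ b ∈ V, b.card = 2 ∧ ZMod.reduce n (v b) = 0 ∧ D.Twisted b (v b) :=
    fun b hb => hW b (Multiset.mem_of_le hVW hb)
  have hVS : V.sum ≤ S := (Multiset.sum_le_sum_of_le hVW).trans hWS
  have hr : ∀ U ≤ V, ZMod.reduce n (U.map v).sum = 0 := by
    intro U hU
    rw [map_multiset_sum, Multiset.map_map]
    refine Multiset.sum_eq_zero fun x hx => ?_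
    obtain ⟨b, hb, rfl⟩ := Multiset.mem_map.1 hx
    exact (hV b (Multiset.mem_of_le hU hb)).2.1
  have hz : ∀ i j : ZMod (2 * n), ZMod.reduce n i = ZMod.reduce n j →
      ZMod.reduce n (c + j - i) = 0 := fun i j h => by
    rw [map_sub, map_add, hc, h, zero_add, sub_self]
  have hVt : D.Twisted V.sum (V.map v).sum := D.twisted_sum fun b hb => (hV b hb).2.2
  have hVsc : V.sum.card + 2 = 4 * n := by
    rw [Multiset.card_sum_of_forall fun b hb => (hV b hb).1, hVc]
    omega
  -- All exponents involved vanish mod `n`, so only parities have to cancel.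
  have hp : ∀ x y : ZMod 2, x + y = 0 ∨ x = y + 1 := by decide
  rcases hp (ZMod.parity n (V.map v).sum) (ZMod.parity n (c + j₁ - i₁)) with hp1 | hp1
  · refine hasProductOne_of_twisted hVt (y := i₁) (z := j₁) ?_ ?_ hVsc
    · refine le_trans ?_ (Multiset.le_add_right _ _)
      gcongr
    · refine ZMod.eq_zero_of_parity_of_reduce hn (by rw [map_add, hp1]) ?_
      rw [map_add, hr V le_rfl, hz _ _ h₁, add_zero]
  rcases hp (ZMod.parity n (V.map v).sum) (ZMod.parity n (c + j₂ - i₂)) with hp2 | hp2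
  · refine hasProductOne_of_twisted hVt (y := i₂) (z := j₂) ?_ ?_ hVsc
    · gcongr
      exact hVS.trans (Multiset.le_add_right _ _)
    · refine ZMod.eq_zero_of_parity_of_reduce hn (by rw [map_add, hp2]) ?_
      rw [map_add, hr V le_rfl, hz _ _ h₂, add_zero]
  -- Both reflection pairs now have the wrong parity. Among the odd number of blocks, one has the
  -- parity of the total; replacing it by the first reflection pair corrects the parity and keeps
  -- the length.
  have hmem := ZMod.sum_mem_of_odd_card (s := (V.map v).map (ZMod.parity n)) (by
    rw [Multiset.card_map, Multiset.card_map, hVc]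
    exact ⟨n - 1, by omega⟩)
  rw [← map_multiset_sum, Multiset.map_map] at hmem
  obtain ⟨b, hb, hbp⟩ := Multiset.mem_map.1 hmem
  obtain ⟨U, rfl⟩ := Multiset.exists_cons_of_mem hb
  have hU : U ≤ b ::ₘ U := Multiset.le_cons_self _ _
  have hUp : ZMod.parity n (U.map v).sum = 0 := by
    rw [Multiset.map_cons, Multiset.sum_cons, map_add, Function.comp_apply] at hbp
    exact left_eq_add.1 hbp
  refine hasProductOne_of_twisted ((D.twisted_sum (V := U) fun b hb =>
    (hV b (Multiset.mem_of_le hU hb)).2.2).add (.of_orderedProd (D.orderedProd_ref_pair i₁ j₁)))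
    (y := i₂) (z := j₂) ?_ ?_ ?_
  · gcongr
    exact (Multiset.sum_le_sum_of_le hU).trans hVS
  · refine ZMod.eq_zero_of_parity_of_reduce hn ?_ ?_
    · rw [map_add, map_add, hUp, zero_add]
      have : ∀ x y z : ZMod 2, z = x + 1 → z = y + 1 → x + y = 0 := by decide
      exact this _ _ _ hp1 hp2
    · rw [map_add, map_add, hr U hU, hz _ _ h₁, hz _ _ h₂, add_zero, add_zero]
  · rw [Multiset.sum_cons, Multiset.card_add, (hV b hb).1] at hVsc
    simp only [Multiset.card_add, Multiset.card_singleton]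
    omega

theorem hasProductOne_of_ref_pair {c : ZMod (2 * n)} {D : DihedralRep G (2 * n) c}
    {R Y p q : Multiset (ZMod (2 * n))} {y z : ZMod (2 * n)} {e : ℕ} (hpq : p + q ≤ R)
    (hY : {y} + {z} ≤ Y) (hs : p.sum - q.sum = -(c + z - y)) (hc : (p + q).card + 2 = e) :
    HasProductOne (R.map D.rot + Y.map D.ref) e := by
  refine hasProductOne_of_twisted (D.twisted_map_rot p q) (y := y) (z := z) ?_
    (by rw [hs, neg_add_cancel]) (by rw [Multiset.card_map, hc])
  have := Multiset.map_le_map (f := D.ref) hY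
  rw [Multiset.map_add, Multiset.map_singleton, Multiset.map_singleton] at this
  exact add_le_add (Multiset.map_le_map hpq) this

/-- Two disjoint pairs of non-rotations agreeing mod `n` suffice by `hasProductOne_of_two_pairs`.
Otherwise there are at most `n + 2` non-rotations, hence at least `5 * n - 2` rotations, whose
signed sums are flexible enough to cancel two or four non-rotations. -/
theorem hasProductOne_of_two_mul_odd (hn : Odd n) (hn1 : n ≠ 1)
    (D : DihedralRep G (2 * n) (n : ZMod (2 * n))) (S : Multiset G) (hS : 6 * n ≤ S.card) :
    HasProductOne S (4 * n) := by
  have : NeZero n := ⟨by rintro rfl; simp at hn⟩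
  have : NeZero (2 * n) := ⟨by have := NeZero.ne n; omega⟩
  have hn3 : 3 ≤ n := by
    obtain ⟨k, rfl⟩ := hn
    omega
  have hcr : ZMod.reduce n (n : ZMod (2 * n)) = 0 := by rw [map_natCast, ZMod.natCast_self]
  have hcp : ZMod.parity n (n : ZMod (2 * n)) = 1 := by
    rw [map_natCast]
    exact (ZMod.natCast_eq_one_iff_odd).2 hn
  obtain ⟨S₀, hS₀, hc⟩ := Multiset.exists_le_card_eq' S hS
  refine HasProductOne.mono ?_ hS₀
  clear hS hS₀ S
  obtain ⟨R, Y, rfl⟩ := D.exists_eq_map_add_map S₀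
  rw [Multiset.card_add, Multiset.card_map, Multiset.card_map] at hc
  obtain ⟨V, L, hVL, hV, hL⟩ := Multiset.exists_pairing (ZMod.reduce n) Y
  have hV2 := Multiset.card_sum_pairs (V := V) fun b hb => by
    obtain ⟨g, h, hb, -⟩ := hV b hb
    exact ⟨g, h, hb⟩
  have hYc := congrArg Multiset.card hVL
  rw [Multiset.card_add, Multiset.card_sum_of_forall hV2] at hYc
  have hLc := Multiset.card_le_of_nodup_map hL
  rw [ZMod.card] at hLc
  rcases le_or_gt 2 V.card with hV1 | hV1
  · obtain ⟨b₁, V, rfl⟩ := Multiset.exists_eq_cons_of_card_pos (by omega : 0 < V.card)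
    rw [Multiset.card_cons] at hV1 hYc
    obtain ⟨b₂, V, rfl⟩ := Multiset.exists_eq_cons_of_card_pos (by omega : 0 < V.card)
    rw [Multiset.card_cons] at hYc
    obtain ⟨i₁, j₁, rfl, h₁⟩ := hV b₁ (by simp)
    obtain ⟨i₂, j₂, rfl, h₂⟩ := hV b₂ (by simp)
    have := hasProductOne_of_two_pairs hn hn1 hcr D (S := R.map D.rot + (V.sum + L).map D.ref) h₁ h₂
      (by
        have hV2' : ∀ b ∈ V, b.card = 2 := fun b hb => hV2 b (by simp [hb])
        rw [Multiset.card_add, Multiset.card_map, Multiset.card_map, Multiset.card_add,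
          Multiset.card_sum_of_forall hV2']
        omega)
    convert this using 1
    rw [← hVL, Multiset.sum_cons, Multiset.sum_cons]
    simp only [Multiset.map_add, Multiset.map_singleton]
    abel
  rcases le_or_gt Y.card 1 with hY | hY
  · obtain ⟨t, ht, htc, ht0⟩ := ZMod.exists_le_card_eq_sum_eq_zero id 2 R (by omega)
    rw [Multiset.map_id] at ht0
    exact hasProductOne_of_rot
      ((Multiset.map_le_map ht).trans (Multiset.le_add_right _ _)) ht0 (by omega)
  by_contra hnot
  have hno : ¬ ∃ t ≤ R, t.card = 4 * n ∧ t.sum = 0 := fun ⟨t, ht, htc, ht0⟩ =>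
    hnot (hasProductOne_of_rot
      ((Multiset.map_le_map ht).trans (Multiset.le_add_right _ _)) ht0 htc)
  by_cases hmix : ∃ a ∈ R, ∃ b ∈ R, ZMod.parity n a ≠ ZMod.parity n b
  · obtain ⟨y, z, hyz, hg⟩ : ∃ y z, {y} + {z} ≤ Y ∧
        (ZMod.reduce n (-(n + z - y)) ≠ 0 ∨ 5 * n ≤ R.card + 1) := by
      by_cases h5 : 5 * n ≤ R.card + 1
      · obtain ⟨y, Y, rfl⟩ := Multiset.exists_eq_cons_of_card_pos (by omega : 0 < Y.card)
        rw [Multiset.card_cons] at hY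
        obtain ⟨z, Y, rfl⟩ := Multiset.exists_eq_cons_of_card_pos (by omega : 0 < Y.card)
        exact ⟨y, z, by
          rw [Multiset.singleton_add]
          exact Multiset.cons_le_cons _ (by simp), Or.inr h5⟩
      -- Here zero mod `n` may be unrepresentable, so `y` and `z` are taken from the leftover terms,
      -- which are distinct mod `n`.
      · have hL2 : 2 ≤ L.card := by omega
        obtain ⟨y, L, rfl⟩ := Multiset.exists_eq_cons_of_card_pos (by omega : 0 < L.card)
        rw [Multiset.card_cons] at hL2
        obtain ⟨z, L, rfl⟩ := Multiset.exists_eq_cons_of_card_pos (by omega : 0 < L.card)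
        refine ⟨y, z, ?_, Or.inl fun h0 => ?_⟩
        · rw [← hVL, Multiset.singleton_add]
          exact (Multiset.cons_le_cons _ (by simp)).trans (Multiset.le_add_left _ _)
        · rw [map_neg, map_sub, map_add, hcr, zero_add, neg_eq_zero, sub_eq_zero] at h0
          simp [h0] at hL
    obtain ⟨p, q, hpq, hpc, hs⟩ :=
      ZMod.exists_signed_sum_of_parity_ne hn hn1 (by omega) hno hmix _ hg
    exact hnot (hasProductOne_of_ref_pair hpq hyz hs hpc)
  push Not at hmix
  obtain ⟨a, ha⟩ := Multiset.card_pos_iff_exists_mem.1 (by omega : 0 < R.card)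
  have hu : ∀ b ∈ R, ZMod.parity n b = ZMod.parity n a := fun b hb => hmix b hb a ha
  -- Taking `K = ⊤` leaves exactly `5 * n - 2` rotations, so `n + 2 ≥ 5` non-rotations.
  have htop := ZMod.card_add_two_le_outside_of_parity_eq hn hno hu ⊤
  rw [outside_eq_zero fun b _ => AddSubgroup.mem_top _, AddSubgroup.card_top, Nat.card_zmod] at htop
  have hYn : Y.card = n + 2 := by omega
  obtain ⟨y₁, Y, rfl⟩ := Multiset.exists_eq_cons_of_card_pos (by omega : 0 < Y.card)
  rw [Multiset.card_cons] at hYn hc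
  obtain ⟨y₂, Y, rfl⟩ := Multiset.exists_eq_cons_of_card_pos (by omega : 0 < Y.card)
  rw [Multiset.card_cons] at hYn hc
  obtain ⟨y₃, Y, rfl⟩ := Multiset.exists_eq_cons_of_card_pos (by omega : 0 < Y.card)
  rw [Multiset.card_cons] at hYn hc
  obtain ⟨y₄, Y, rfl⟩ := Multiset.exists_eq_cons_of_card_pos (by omega : 0 < Y.card)
  have hY4 : y₁ ::ₘ y₂ ::ₘ y₃ ::ₘ y₄ ::ₘ Y = {y₁} + {y₂} + ({y₃} + {y₄}) + Y := by
    simp only [← Multiset.singleton_add]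
    abel
  rw [hY4] at hnot
  have hsig : ∀ y z : ZMod (2 * n), ZMod.parity n y = ZMod.parity n z ∨
      ZMod.parity n (-(n + z - y)) = 0 := by
    intro y z
    rw [map_neg, map_sub, map_add, hcp]
    generalize ZMod.parity n y = u
    generalize ZMod.parity n z = w
    revert u w
    decide
  -- Signed sums of an even number of rotations of one parity are even. As `n` is odd, two
  -- non-rotations of different parity could be cancelled.
  have hpair : ∀ y z, {y} + {z} ≤ ({y₁} + {y₂} + ({y₃} + {y₄}) + Y : Multiset (ZMod (2 * n))) →
      ZMod.parity n y = ZMod.parity n z := by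
    intro y z hyz
    refine (hsig y z).resolve_right fun h0 => ?_
    obtain ⟨p, q, hpq, hpc, hs⟩ := ZMod.exists_signed_sum_of_parity_eq hn (by omega) hno hu _ h0
      (M := 4 * n - 2) ⟨2 * n - 1, by omega⟩ (by omega) (by omega)
    exact hnot (hasProductOne_of_ref_pair hpq hyz hs (by omega))
  have h12 := hpair y₁ y₂ ((Multiset.le_add_right _ _).trans (Multiset.le_add_right _ _))
  have h34 := hpair y₃ y₄ ((Multiset.le_add_left _ _).trans (Multiset.le_add_right _ _))
  -- Each pair of equal parity contributes an odd exponent; two pairs together contribute an even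
  -- one, to be cancelled by `4 * n - 4` rotations.
  obtain ⟨p, q, hpq, hpc, hs⟩ := ZMod.exists_signed_sum_of_parity_eq hn (by omega) hno hu
    (-(n + y₂ - y₁) - (n + y₄ - y₃)) (by
      simp only [map_sub, map_neg, map_add, hcp, h12, h34]
      generalize ZMod.parity n y₂ = u
      generalize ZMod.parity n y₄ = w
      revert u w
      decide)
    (M := 4 * n - 4) ⟨2 * n - 2, by omega⟩ (by omega) (by omega)
  refine hnot (hasProductOne_of_twisted ((D.twisted_map_rot p q).add
    (.of_orderedProd (D.orderedProd_ref_pair y₁ y₂))) (y := y₃) (z := y₄) ?_ ?_ ?_)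
  · rw [add_assoc]
    refine add_le_add (Multiset.map_le_map hpq) ?_
    simp only [Multiset.map_add, Multiset.map_singleton]
    exact Multiset.le_add_right _ _
  · rw [hs]
    abel
  · simp only [Multiset.card_add, Multiset.card_singleton, Multiset.card_map] at hpc ⊢
    omega

end DihedralRep

/-! ### The lower bound and the main theorem -/

namespace DihedralRep

variable {G : Type*} [Group G] {m : ℕ} {c : ZMod m} (D : DihedralRep G m c)

theorem list_prod_eq_rot {l : List G} {R : Multiset (ZMod m)}
    (h : (l : Multiset G) = R.map D.rot) : l.prod = D.rot R.sum := by
  classical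
  induction l generalizing R with
  | nil =>
    rw [Multiset.coe_nil, eq_comm, Multiset.map_eq_zero] at h
    rw [h, Multiset.sum_zero, D.rot_zero, List.prod_nil]
  | cons a l ih =>
    rw [← Multiset.cons_coe, eq_comm, ← Multiset.map_eq_cons] at h
    obtain ⟨i, hi, rfl, hR⟩ := h
    rw [List.prod_cons, ih hR.symm, D.rot_mul_rot, Multiset.sum_erase hi]

theorem not_isProductOne_of_ref_mem {T : Multiset G} {R : Multiset (ZMod m)} {y : ZMod m}
    (hy : D.ref y ∈ T) (hT : T ≤ R.map D.rot + {D.ref y}) : ¬ IsProductOne T := by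
  classical
  rintro ⟨l, rfl, hl⟩
  obtain ⟨l₁, l₂, rfl⟩ := List.append_of_mem (Multiset.mem_coe.1 hy)
  have hT' : ((l₁ : Multiset G) + l₂) + {D.ref y} ≤ R.map D.rot + {D.ref y} := by
    convert hT using 1
    rw [← Multiset.coe_add, ← Multiset.cons_coe, ← Multiset.singleton_add]
    abel
  rw [add_le_add_iff_right] at hT'
  obtain ⟨R₁, -, h₁⟩ := Multiset.exists_map_eq_of_le_map ((Multiset.le_add_right _ _).trans hT')
  obtain ⟨R₂, -, h₂⟩ := Multiset.exists_map_eq_of_le_map ((Multiset.le_add_left _ _).trans hT')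
  rw [List.prod_append, List.prod_cons, D.list_prod_eq_rot h₁.symm, D.list_prod_eq_rot h₂.symm,
    D.ref_mul_rot, D.rot_mul_ref, ← D.rot_zero] at hl
  exact D.rot_ne_ref _ _ hl.symm

theorem exists_not_hasProductOne (D : DihedralRep G m c) {e : ℕ} (hme : m ∣ e) (he : e ≠ 0) :
    ∃ S : Multiset G, S.card + 1 = e + m ∧ ¬ HasProductOne S e := by
  classical
  have hm : m ≠ 0 := by
    rintro rfl
    exact he (zero_dvd_iff.1 hme)
  refine ⟨(Multiset.replicate (e - 1) (1 : ZMod m) + Multiset.replicate (m - 1) 0).map D.rot +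
    {D.ref 0},
    ?_, ?_⟩
  · simp only [Multiset.card_add, Multiset.card_map, Multiset.card_replicate,
      Multiset.card_singleton]
    omega
  · rintro ⟨T, hT, hTc, hT1⟩
    by_cases hy : D.ref 0 ∈ T
    · exact D.not_isProductOne_of_ref_mem hy hT hT1
    · rw [← Multiset.sub_le_iff_le_add, Multiset.sub_singleton, Multiset.erase_of_notMem hy] at hT
      obtain ⟨R, hR, rfl⟩ := Multiset.exists_map_eq_of_le_map hT
      obtain ⟨l, hl, hl1⟩ := hT1
      rw [D.list_prod_eq_rot hl, ← D.rot_zero] at hl1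
      have hl0 := D.rot_injective hl1
      obtain ⟨u, hu, hRu⟩ := Multiset.le_replicate_iff.1
        (Multiset.sub_le_iff_le_add.2 hR)
      obtain ⟨v, hv, hRv⟩ := Multiset.le_replicate_iff.1
        (Multiset.inter_le_right (s := R) (t := Multiset.replicate (m - 1) 0))
      have hadd := Multiset.sub_add_inter R (Multiset.replicate (m - 1) 0)
      rw [hRu, hRv] at hadd
      rw [← hadd] at hl0 hTc
      simp only [Multiset.sum_add, Multiset.sum_replicate, nsmul_eq_mul, mul_one, mul_zero,
        add_zero, ZMod.natCast_eq_zero_iff] at hl0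
      simp only [Multiset.card_map, Multiset.card_add, Multiset.card_replicate] at hTc
      -- A vanishing sum gives `m ∣ u`, and `u + v = e` gives `m ∣ v` with `v ≤ m - 1`. So `v = 0`,
      -- contradicting `u ≤ e - 1`.
      have hv0 : m ∣ v := (Nat.dvd_add_right hl0).1 (hTc ▸ hme)
      have := Nat.eq_zero_of_dvd_of_lt hv0 (by omega)
      omega

end DihedralRep

/-! ### Invariance under isomorphism and the values of the constant -/

section Constant

variable {G H : Type*} [Group G] [Group H]

theorem egzLengths_subset_of_mulEquiv (φ : G ≃* H) : egzLengths H ⊆ egzLengths G := by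
  intro ℓ hℓ S hS
  obtain ⟨T, hT, hTc, g, hg, hTg⟩ := HasProductOne.exists_of_map φ.toMonoidHom
    (hℓ (S.map φ) (by rwa [Multiset.card_map]))
  obtain rfl : g = 1 := by simpa using hg
  exact ⟨T, hT, by rw [hTc, Monoid.exponent_eq_of_mulEquiv φ], hTg⟩

theorem IsEGZConstant.of_mulEquiv (φ : G ≃* H) {ℓ : ℕ} (h : IsEGZConstant H ℓ) :
    IsEGZConstant G ℓ :=
  ⟨egzLengths_subset_of_mulEquiv φ h.1, fun _ hk => h.2 (egzLengths_subset_of_mulEquiv φ.symm hk)⟩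

theorem DihedralRep.isEGZConstant {m : ℕ} {c : ZMod m} (D : DihedralRep G m c) {e ℓ : ℕ}
    (he : Monoid.exponent G = e) (hme : m ∣ e) (he0 : e ≠ 0) (hℓ : ℓ = e + m)
    (h : ∀ S : Multiset G, ℓ ≤ S.card → HasProductOne S e) : IsEGZConstant G ℓ := by
  subst he
  refine ⟨h, fun k hk => ?_⟩
  by_contra hlt
  obtain ⟨S, hS, hno⟩ := D.exists_not_hasProductOne hme he0
  exact hno (hk S (by omega))

end Constant

theorem DihedralGroup.isEGZConstant {n : ℕ} (hn : 3 ≤ n) :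
    IsEGZConstant (DihedralGroup n) (if Odd n then 3 * n else 2 * n) := by
  have hexp : Monoid.exponent (DihedralGroup n) = Nat.lcm n 2 := DihedralGroup.exponent
  split_ifs with h
  · rw [Nat.Coprime.lcm_eq_mul (Nat.coprime_two_right.2 h), mul_comm] at hexp
    exact (dihedralRep n).isEGZConstant hexp ⟨2, mul_comm _ _⟩ (by omega) (by ring)
      (DihedralRep.hasProductOne_of_odd h (dihedralRep n))
  · rw [Nat.not_odd_iff_even] at h
    rw [Nat.lcm_eq_left h.two_dvd] at hexp
    refine (dihedralRep n).isEGZConstant hexp dvd_rfl (by omega) (by ring)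
      (hasProductOne_of_even h ?_)
    obtain ⟨k, rfl⟩ := h
    omega

theorem QuaternionGroup.isEGZConstant {n : ℕ} (hn : 2 ≤ n) :
    IsEGZConstant (QuaternionGroup n) (if Odd n then 6 * n else 4 * n) := by
  have hexp : Monoid.exponent (QuaternionGroup n) = 2 * Nat.lcm n 2 := QuaternionGroup.exponent
  split_ifs with h
  · rw [Nat.Coprime.lcm_eq_mul (Nat.coprime_two_right.2 h)] at hexp
    exact (dihedralRep n).isEGZConstant (e := 4 * n) (by rw [hexp]; ring) ⟨2, by ring⟩ (by omega)
      (by ring) (DihedralRep.hasProductOne_of_two_mul_odd h (by omega) (dihedralRep n))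
  · rw [Nat.not_odd_iff_even] at h
    rw [Nat.lcm_eq_left h.two_dvd] at hexp
    exact (dihedralRep n).isEGZConstant hexp dvd_rfl (by omega) (by ring)
      (hasProductOne_of_even h hn)

theorem theorem1p1 {G : Type*} [Group G] (n : ℕ) :
    (3 ≤ n → IsDihedralOfOrderTwoMul G n →
      IsEGZConstant G (if Odd n then 3 * n else 2 * n)) ∧
    (2 ≤ n → IsDicyclicOfOrderFourMul G n →
      IsEGZConstant G (if Odd n then 6 * n else 4 * n)) :=
  ⟨fun hn ⟨φ⟩ => (DihedralGroup.isEGZConstant hn).of_mulEquiv φ,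
    fun hn ⟨φ⟩ => (QuaternionGroup.isEGZConstant hn).of_mulEquiv φ⟩
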